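/- \textbf{Setting.} A layered network has a finite set of supernodes, distributed over layers $1,\dots,\lambda$, each with $n$ input ports $x^V_1,\dots,x^V_n$ and $n$ output ports $y^V_1,\dots,y^V_n$; links lead from output ports of layer $l$ to input ports of layer $l+1$. The source $S$ lies in layer $1$, and every layer has at most $N_{layer}$ supernodes, which are linearly ordered. Let $R\ge 0$ be an integer and $\mathbb F_q$ a finite field. For a supernode $T\ne S$, $mincut(S,T)$ is the minimum, over all sets $\Omega$ of supernodes with $S\in\Omega$, $T\notin\Omega$, of the rank over $\mathbb F_q$ of the $0$-$1$ incidence matrix $G_\Omega$ between the output ports in $\Omega$ and the input ports outside $\Omega$. Let $W$ be a set of $R$ ports of supernodes of one layer, not containing both input and output ports of the same supernode. Its virtual sink $T(W)$ is a new supernode obtained as follows. Output ports in $W$ are connected to $T(W)$. For each supernode $V$ with $p\ge 1$ input ports in $W$, the other input ports of $V$ are disconnected and $y^V_1,\dots,y^V_p$ are connected to $T(W)$. Each connected output port has its own input port of $T(W)$. $W$ is \emph{regular} if $mincut(S,T(W))=R$ in the network so modified. A code assigns coefficients $\beta_{(x_i^V,y_j^V)}\in\mathbb F_q$ and one virtual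 coefficient $k_y\in\mathbb F_q$ to each output port $y$. Coding vectors in $\mathbb F_q^R$ satisfy $\mathbf y^V_j=\sum_i\beta_{(x_i^V,y_j^V)}\mathbf x^V_i$; for $V\neq S$, $\mathbf x^V_i=\sum_{y}k_{y}\mathbf y$ over the output ports $y$ linked to $x^V_i$; and $\mathbf x^S_i$ is the $i$-th standard basis vector for $i\le R$ and $0$ for $i>R$. Symbols in $\mathbb F_q$ obey the same equations, with source inputs $u_1,\dots,u_R,0,\dots,0$. For a set $D$ of supernodes of layer $l$, let $Q_l(D)$ consist of the output ports of the supernodes in $D$ and the input ports of the other supernodes of layer $l$ (for $S$, only its $R$ upper input ports). The \emph{invariant} holds for a set $Q$ of ports if every regular $R$-subset of $Q$ has linearly independent coding vectors. \textbf{Theorem.} \begin{enumerate} \item Let $1\le l\le\lambda-1$. For every regular set $W'$ of $R$ input ports of layer $l+1$ there is a regular set $W$ of $R$ output ports of layer $l$ such that the $R\times R$ incidence matrix $G_{(W,W')}$ has full rank over $\mathbb F_q$. \item Let $q>2\binom{nN_{layer}}{R}$ and $1\le l\le\lambda-1$. If the invariant holds for the output ports of layer $l$ that have an outgoing link, with any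 given coding vectors, then coefficients $k_y$ can be chosen such that, simultaneously, every regular set of $R$ input ports of layer $l+1$ has linearly independent coding vectors $\mathbf x=\sum_y k_y\mathbf y$. \item Let $q>n\binom{nN_{layer}}{R}$, $1\le l\le\lambda$, let $D$ be a set of supernodes of layer $l$ and $V\notin D$ a supernode of layer $l$. If the invariant holds for $Q_l(D)$, with any given coding vectors, then the coefficients $\beta_{(x_i^V,y_j^V)}$ can be chosen such that, with the resulting $\mathbf y^V_j$, the invariant holds for $Q_l(D\cup\{V\})$. \item Let $q>\max(2,n)\binom{nN_{layer}}{R}$. Then there is a code whose coding vectors satisfy the invariant for $Q_l(D)$ for every layer $l$ and every initial segment $D$ of layer $l$, and with which every supernode $V\ne S$ with $mincut(S,V)\ge R$ can decode: there are $\epsilon_{r,i}\in\mathbb F_q$ such that for all source data $u\in\mathbb F_q^R$ the symbols $s_i$ received at $x_i^V$ satisfy $\sum_{i=1}^n\epsilon_{r,i}s_i=u_r$ for $1\le r\le R$. \end{enumerate} -/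

import Mathlib

open scoped BigOperators

/-- A (deterministic, ADT type) network: `V` is the set of supernodes, `I` and `O` are the sets of
input and output ports, and a link leads from an output port to an input port. -/
structure ADTNetwork (V I O : Type*) where
  /-- the supernode an input port belongs to -/
  inNode : I → V
  /-- the supernode an output port belongs to -/
  outNode : O → V
  /-- `link y x`: there is a link from the output port `y` to the input port `x` -/
  link : O → I → Prop

namespace ADTNetwork

variable {V I O : Type*}

open Classical in
/-- The 0-1 incidence matrix of the links, with entries in the field `F`. -/
noncomputable def incidence (F : Type*) [Field F] (G : ADTNetwork V I O) : Matrix O I F :=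
  Matrix.of fun y x => if G.link y x then 1 else 0

open Classical in
/-- The rank of the incidence matrix `G_Ω` of the bipartite graph formed by the output ports of the
supernodes in `Ω` and the input ports of the supernodes outside `Ω`. -/
noncomputable def cutRank (F : Type*) [Field F] [Fintype I] (G : ADTNetwork V I O)
    (Ω : Set V) : ℕ :=
  ((G.incidence F).submatrix
    (fun y : {y : O // G.outNode y ∈ Ω} => y.1)
    (fun x : {x : I // G.inNode x ∉ Ω} => x.1)).rank

/-- `mincut(S, T)`: the minimum of `rank G_Ω` over all cuts `Ω` with `S ∈ Ω` and `T ∉ Ω`.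
(For `T = S` there is no cut and the value is `⊤`.) -/
noncomputable def mincut (F : Type*) [Field F] [Fintype I] (G : ADTNetwork V I O)
    (S T : V) : ℕ∞ :=
  ⨅ Ω : {Ω : Set V // S ∈ Ω ∧ T ∉ Ω}, (G.cutRank F Ω.1 : ℕ∞)

end ADTNetwork

/-- `(v, i)` is the `i`-th input port of the supernode `v`, counted from the top. -/
abbrev InPort (V : Type*) (n : ℕ) : Type _ := V × Fin n

/-- `(v, j)` is the `j`-th output port of the supernode `v`, counted from the top. -/
abbrev OutPort (V : Type*) (n : ℕ) : Type _ := V × Fin n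

/-- A port: `Sum.inl` of an input port or `Sum.inr` of an output port. -/
abbrev Port (V : Type*) (n : ℕ) : Type _ := InPort V n ⊕ OutPort V n

/-- The supernode of a port. -/
def Port.node {V : Type*} {n : ℕ} (p : Port V n) : V := Sum.elim Prod.fst Prod.fst p

/-- A layered network with layers `1, …, depth`, in which each supernode has `n` input ports and
`n` output ports, the source is in layer 1, and all links lead from one layer to the next. -/
structure LayeredNetwork (V : Type*) (n : ℕ) where
  depth : ℕ
  layer : V → ℕ
  layer_pos : ∀ v, 1 ≤ layer v
  layer_le : ∀ v, layer v ≤ depth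
  source : V
  layer_source : layer source = 1
  link : OutPort V n → InPort V n → Prop
  layer_link : ∀ y x, link y x → layer x.1 = layer y.1 + 1

namespace LayeredNetwork

variable {V : Type*} {n : ℕ}

/-- The network itself, without its layers. -/
def toADT (N : LayeredNetwork V n) : ADTNetwork V (InPort V n) (OutPort V n) where
  inNode := Prod.fst
  outNode := Prod.fst
  link := N.link

open Classical in
/-- The output ports that are connected to the virtual sink `T(W)`: the output ports in `W`, and,
for each supernode with `p` input ports in `W`, its `p` upper output ports. -/
def tapped (W : Finset (Port V n)) : Set (OutPort V n) :=
  {y | Sum.inr y ∈ W ∨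
    (y.2 : ℕ) < (Finset.univ.filter fun i : Fin n => Sum.inl (y.1, i) ∈ W).card}

/-- The input ports that are disconnected in the presence of the virtual sink `T(W)`: those outside
`W` that belong to a supernode with at least one input port in `W`. -/
def disconnected (W : Finset (Port V n)) : Set (InPort V n) :=
  {x | Sum.inl x ∉ W ∧ ∃ i : Fin n, Sum.inl (x.1, i) ∈ W}

/-- The network with the virtual sink `T(W)`, which is the supernode `none`. The sink has one input
port for each tapped output port, and is linked to exactly that port by it. -/
def virtualSink (N : LayeredNetwork V n) (W : Finset (Port V n)) :
    ADTNetwork (Option V) (InPort V n ⊕ {y : OutPort V n // y ∈ tapped W}) (OutPort V n) where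
  inNode := Sum.elim (fun x => some x.1) (fun _ => none)
  outNode := fun y => some y.1
  link := fun y => Sum.elim (fun x => N.link y x ∧ x ∉ disconnected W) (fun z => y = z.1)

open Classical in
/-- A regular set: a set of `R` ports of supernodes of a single layer, not containing both input
and output ports of the same supernode, such that `mincut(S, T(W)) = R`. -/
structure IsRegular [Fintype V] (F : Type*) [Field F] (N : LayeredNetwork V n) (R : ℕ)
    (W : Finset (Port V n)) : Prop where
  card_eq : W.card = R
  same_layer : ∃ l, ∀ p ∈ W, N.layer p.node = l
  not_both : ∀ v i j, Sum.inl (v, i) ∈ W → Sum.inr (v, j) ∉ W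
  mincut_eq : (N.virtualSink W).mincut F (some N.source) none = (R : ℕ∞)

/-- The ports of layer `l` under consideration once the supernodes of the set `D` have had their
output ports coded: the output ports of the supernodes in `D` and the input ports of the others.
Only the `R` upper input ports of the source, which carry the data, take part. -/
def frontier (N : LayeredNetwork V n) (R l : ℕ) (D : Set V) : Set (Port V n) :=
  {p | N.layer p.node = l ∧
    Sum.elim (fun x : InPort V n => x.1 ∉ D ∧ (x.1 = N.source → (x.2 : ℕ) < R))
      (fun y : OutPort V n => y.1 ∈ D) p}

/-- The input ports of layer `l`. -/
def layerInputs (N : LayeredNetwork V n) (l : ℕ) : Set (Port V n) :=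
  {p | ∃ x : InPort V n, N.layer x.1 = l ∧ p = Sum.inl x}

/-- The output ports of layer `l` that have at least one outgoing link. -/
def linkedOutputs (N : LayeredNetwork V n) (l : ℕ) : Set (Port V n) :=
  {p | ∃ y : OutPort V n, N.layer y.1 = l ∧ (∃ x, N.link y x) ∧ p = Sum.inr y}

/-- The code invariant for the set of ports `Q`: every regular subset of `Q` of size `R` has
linearly independent coding vectors. Here `x` and `y` are the coding vectors of the input and of
the output ports. -/
def Invariant [Fintype V] {F : Type*} [Field F] (N : LayeredNetwork V n) (R : ℕ)
    (Q : Set (Port V n)) (x : InPort V n → Fin R → F) (y : OutPort V n → Fin R → F) : Prop :=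
  ∀ W : Finset (Port V n), (∀ p ∈ W, p ∈ Q) → N.IsRegular F R W →
    LinearIndependent F (fun p : {p : Port V n // p ∈ W} => Sum.elim x y p.1)

open Classical in
/-- What the input port `x` receives when each output port `y'` carries `k y' • y y'`: the sum over
all output ports that are linked to `x`. The coefficient depends on the output port only. -/
noncomputable def received [Fintype V] {F M : Type*} [Field F] [AddCommGroup M] [Module F M]
    (N : LayeredNetwork V n) (k : OutPort V n → F) (y : OutPort V n → M) (x : InPort V n) : M :=
  ∑ y' ∈ Finset.univ.filter (fun y' : OutPort V n => N.link y' x), k y' • y y'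

end LayeredNetwork

open Classical in
/-- The coding vectors of the output ports after the supernode `v` has been given the internal
coding coefficients `b i j`; those of the other supernodes are kept. -/
noncomputable def recode {V : Type*} {n : ℕ} {F M : Type*} [Field F] [AddCommGroup M] [Module F M]
    (v : V) (b : Fin n → Fin n → F) (x : InPort V n → M) (y : OutPort V n → M) :
    OutPort V n → M :=
  fun p => if p.1 = v then ∑ i, b i p.2 • x (v, i) else y p

/-- A linear network code: `β v i j` is the internal coefficient from the `i`-th input port to the
`j`-th output port of `v`, and `k y` is the virtual coding coefficient of the output port `y`. -/
structure LinearCode (V : Type*) (n : ℕ) (F : Type*) where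
  β : V → Fin n → Fin n → F
  k : OutPort V n → F

/-- The input of the source: `u` on the `R` upper input ports, and zero on the lower ones. -/
def sourceInput {M : Type*} [Zero M] (n : ℕ) {R : ℕ} (u : Fin R → M) : Fin n → M :=
  fun i => if h : (i : ℕ) < R then u ⟨i, h⟩ else 0

/-- `x` and `y` are the values on the input and output ports that result when the network uses the
code `c` and the source has the input `s`. The values lie in an `F`-module: in `F` itself for
symbols, and in `F^R` for coding vectors. -/
structure LinearCode.Transmits {V : Type*} [Fintype V] {n : ℕ} {F M : Type*} [Field F]
    [AddCommGroup M] [Module F M] (c : LinearCode V n F) (N : LayeredNetwork V n)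
    (s : Fin n → M) (x : InPort V n → M) (y : OutPort V n → M) : Prop where
  source_eq : ∀ i, x (N.source, i) = s i
  input_eq : ∀ v, v ≠ N.source → ∀ i, x (v, i) = N.received c.k y (v, i)
  output_eq : ∀ v j, y (v, j) = ∑ i, c.β v i j • x (v, i)

/-!
Bordering the incidence matrix of the links by identity matrices makes every port both a row and a
column. The rank of a block of a matrix is submodular in the pair of its index sets, so the minimum
over all cuts of the rank of the bordered block, the capacity of a set of ports, behaves like the
rank function of a matroid. Cuts of the network with a virtual sink can be traded for cuts of the
original network, which shows that `mincut(S, T(W))` is the capacity of `W`: the regular sets are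
the independent sets of size `R`. Two matroid arguments then give the combinatorics. Matroid
intersection, applied to the capacity of output ports of a layer and to the rank of their links to
`W'`, yields the regular set that feeds `W'` with full rank. Exchange turns a regular set containing
output ports of a supernode into one that contains as many of its input ports instead.

For the coefficients, each regular set imposes the condition that its coding vectors be independent,
and the combinatorics provides coefficients that satisfy this condition alone. Along a line in one
coefficient the vectors move by multiples of a single fixed vector, so that an independent family
becomes dependent for at most one value. As there are at most `(n * Nlayer).choose R` regular sets
to respect, in a larger field the coefficients can be fixed one after another without spoiling any
of them. A supernode `v` whose mincut is at least `R` has a regular set of `R` input ports, and it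
decodes because their coding vectors form a basis.
-/

open Module Submodule

/-- The rank of the block of `M` with rows in `X` and columns in `Y`. It is encoded as the dimension
of the span of the rows, restricted to `Y`, so that neither index type has to be finite. -/
noncomputable def blockRank {F O I : Type*} [Field F] (M : Matrix O I F) (X : Set O) (Y : Set I) :
    ℕ :=
  finrank F ((span F (M.row '' X)).map (LinearMap.funLeft F F ((↑) : Y → I)))

section BlockRank

variable {F O I : Type*} [Field F] (M : Matrix O I F)

lemma blockRank_submatrix {O' I' : Type*} (f : O' → O) (e : I' → I) (X : Set O') (Y : Set I') :
    blockRank (M.submatrix f e) X Y = blockRank M (f '' X) (e '' Y) := by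
  let g : Y → e '' Y := fun x => ⟨e x, x, x.2, rfl⟩
  have hg : Function.Surjective g := fun ⟨_, x, hx, h⟩ => ⟨⟨x, hx⟩, Subtype.ext h⟩
  have hrows : (M.submatrix f e).row '' X = LinearMap.funLeft F F e '' (M.row '' (f '' X)) := by
    simp only [Set.image_image]
    rfl
  rw [blockRank, blockRank, hrows, ← map_span, ← Submodule.map_comp,
    (equivMapOfInjective _ (LinearMap.funLeft_injective_of_surjective F F g hg) _).finrank_eq,
    ← Submodule.map_comp]
  rfl

lemma blockRank_univ [Finite O] [Fintype I] : blockRank M .univ .univ = M.rank := by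
  rw [Matrix.rank_eq_finrank_span_row, blockRank, Set.image_univ]
  exact (equivMapOfInjective _ (LinearMap.funLeft_injective_of_surjective F F _
    fun x => ⟨⟨x, trivial⟩, rfl⟩) _).finrank_eq.symm

lemma rank_submatrix_eq_blockRank {O' I' : Type*} [Finite O'] [Fintype I'] (f : O' → O)
    (e : I' → I) : (M.submatrix f e).rank = blockRank M (.range f) (.range e) := by
  rw [← blockRank_univ, blockRank_submatrix, Set.image_univ, Set.image_univ]

variable {M} in
lemma blockRank_congr {M' : Matrix O I F} {X : Set O} {Y : Set I}
    (h : ∀ y ∈ X, ∀ x ∈ Y, M y x = M' y x) : blockRank M X Y = blockRank M' X Y := by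
  have hrows : LinearMap.funLeft F F ((↑) : Y → I) '' (M.row '' X) =
      LinearMap.funLeft F F ((↑) : Y → I) '' (M'.row '' X) := by
    simp only [Set.image_image]
    exact Set.image_congr fun y hy => funext fun x => h y hy x x.2
  rw [blockRank, blockRank, map_span, map_span, hrows]

lemma blockRank_mono [Finite I] {X X' : Set O} {Y Y' : Set I} (hX : X ⊆ X') (hY : Y ⊆ Y') :
    blockRank M X Y ≤ blockRank M X' Y' :=
  calc blockRank M X Y
    _ ≤ blockRank M X' Y := finrank_mono (map_mono (span_mono (Set.image_mono hX)))
    _ = finrank F (((span F (M.row '' X')).map (LinearMap.funLeft F F ((↑) : Y' → I))).map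
          (LinearMap.funLeft F F (Set.inclusion hY))) := by
        rw [← Submodule.map_comp]
        rfl
    _ ≤ blockRank M X' Y' := finrank_map_le _ _

variable {M} in
lemma blockRank_eq_zero {X : Set O} {Y : Set I} (h : ∀ y ∈ X, ∀ x ∈ Y, M y x = 0) :
    blockRank M X Y = 0 := by
  rw [blockRank, map_span, span_eq_bot.2, finrank_bot]
  rintro _ ⟨_, ⟨y, hy, rfl⟩, rfl⟩
  exact funext fun x => h y hy x x.2

lemma blockRank_le_ncard_left [Finite O] (X : Set O) (Y : Set I) :
    blockRank M X Y ≤ X.ncard := by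
  have := Fintype.ofFinite X
  rw [blockRank, map_span, Set.image_image, Set.image_eq_range, ← Nat.card_coe_set_eq,
    Nat.card_eq_fintype_card]
  exact finrank_range_le_card _

lemma blockRank_le_ncard_right [Finite I] (X : Set O) (Y : Set I) :
    blockRank M X Y ≤ Y.ncard := by
  have := Fintype.ofFinite Y
  rw [← Nat.card_coe_set_eq, Nat.card_eq_fintype_card, ← finrank_fintype_fun_eq_card F]
  exact Submodule.finrank_le _

lemma mem_ker_funLeft_coe {Y : Set I} {v : I → F} :
    v ∈ LinearMap.ker (LinearMap.funLeft F F ((↑) : Y → I)) ↔ ∀ x ∈ Y, v x = 0 := by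
  simp only [LinearMap.mem_ker, funext_iff, LinearMap.funLeft_apply, Subtype.forall,
    Pi.zero_apply]

lemma ker_funLeft_union (Y₁ Y₂ : Set I) :
    LinearMap.ker (LinearMap.funLeft F F ((↑) : ↥(Y₁ ∪ Y₂) → I)) =
      LinearMap.ker (LinearMap.funLeft F F ((↑) : Y₁ → I)) ⊓
        LinearMap.ker (LinearMap.funLeft F F ((↑) : Y₂ → I)) := by
  ext v
  simp only [mem_inf, mem_ker_funLeft_coe, Set.mem_union, or_imp, forall_and]

lemma ker_funLeft_inter (Y₁ Y₂ : Set I) :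
    LinearMap.ker (LinearMap.funLeft F F ((↑) : ↥(Y₁ ∩ Y₂) → I)) =
      LinearMap.ker (LinearMap.funLeft F F ((↑) : Y₁ → I)) ⊔
        LinearMap.ker (LinearMap.funLeft F F ((↑) : Y₂ → I)) := by
  classical
  ext v
  simp only [mem_sup, mem_ker_funLeft_coe]
  constructor
  · intro h
    refine ⟨Y₁ᶜ.indicator v, fun x hx => Set.indicator_of_notMem (not_not_intro hx) v,
      Y₁.indicator v, fun x hx => ?_, Set.indicator_compl_add_self _ _⟩
    exact Set.indicator_apply_eq_zero.2 fun hx₁ => h x ⟨hx₁, hx⟩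
  · rintro ⟨a, ha, b, hb, rfl⟩ x ⟨h₁, h₂⟩
    rw [Pi.add_apply, ha x h₁, hb x h₂, add_zero]

lemma finrank_map_add_finrank_ker {E E' : Type*} [AddCommGroup E] [Module F E]
    [AddCommGroup E'] [Module F E'] [FiniteDimensional F E] (f : E →ₗ[F] E') (S : Submodule F E) :
    finrank F (S.map f) + finrank F (LinearMap.ker f) = finrank F ↥(S ⊔ LinearMap.ker f) := by
  have hmap : (S ⊔ LinearMap.ker f).map f = S.map f := by
    rw [Submodule.map_sup, (LinearMap.le_ker_iff_map (f := f)).1 le_rfl, sup_bot_eq]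
  rw [← LinearMap.finrank_range_add_finrank_ker (f.domRestrict (S ⊔ LinearMap.ker f)),
    LinearMap.range_domRestrict, LinearMap.ker_domRestrict, hmap,
    (comapSubtypeEquivOfLe (le_sup_right : LinearMap.ker f ≤ S ⊔ LinearMap.ker f)).finrank_eq]

/-- With `K Y` the functions that vanish on `Y`, the rank of a block is
`dim (span X + K Y) - dim (K Y)`, so this is the dimension formula for sums and intersections. -/
lemma blockRank_submodular [Finite I] (X₁ X₂ : Set O) (Y₁ Y₂ : Set I) :
    blockRank M (X₁ ∪ X₂) (Y₁ ∩ Y₂) + blockRank M (X₁ ∩ X₂) (Y₁ ∪ Y₂) ≤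
      blockRank M X₁ Y₁ + blockRank M X₂ Y₂ := by
  let K (Y : Set I) : Submodule F (I → F) := LinearMap.ker (LinearMap.funLeft F F ((↑) : Y → I))
  let S (X : Set O) : Submodule F (I → F) := span F (M.row '' X)
  have hrank (X Y) : blockRank M X Y + finrank F (K Y) = finrank F ↥(S X ⊔ K Y) :=
    finrank_map_add_finrank_ker _ _
  have hsup : S X₁ ⊔ K Y₁ ⊔ (S X₂ ⊔ K Y₂) = S (X₁ ∪ X₂) ⊔ K (Y₁ ∩ Y₂) := by
    simp only [S, K, Set.image_union, span_union, ker_funLeft_inter]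
    exact _root_.sup_sup_sup_comm _ _ _ _
  have hinf : S (X₁ ∩ X₂) ⊔ K (Y₁ ∪ Y₂) ≤ (S X₁ ⊔ K Y₁) ⊓ (S X₂ ⊔ K Y₂) := by
    simp only [K, ker_funLeft_union]
    exact le_inf
      (sup_le_sup (span_mono (Set.image_mono Set.inter_subset_left)) inf_le_left)
      (sup_le_sup (span_mono (Set.image_mono Set.inter_subset_right)) inf_le_right)
  have hK := finrank_sup_add_finrank_inf_eq (K Y₁) (K Y₂)
  rw [← ker_funLeft_union, ← ker_funLeft_inter] at hK
  have hSK := finrank_sup_add_finrank_inf_eq (S X₁ ⊔ K Y₁) (S X₂ ⊔ K Y₂)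
  rw [hsup] at hSK
  linarith [finrank_mono hinf, hrank X₁ Y₁, hrank X₂ Y₂, hrank (X₁ ∪ X₂) (Y₁ ∩ Y₂),
    hrank (X₁ ∩ X₂) (Y₁ ∪ Y₂)]

lemma blockRank_union_left_le [Finite I] (X₁ X₂ : Set O) (Y : Set I) :
    blockRank M (X₁ ∪ X₂) Y ≤ blockRank M X₁ Y + blockRank M X₂ Y := by
  have h := blockRank_submodular M X₁ X₂ Y Y
  rw [Set.inter_self] at h
  exact le_of_add_le_left h

lemma blockRank_union_right_le [Finite I] (X : Set O) (Y₁ Y₂ : Set I) :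
    blockRank M X (Y₁ ∪ Y₂) ≤ blockRank M X Y₁ + blockRank M X Y₂ := by
  have h := blockRank_submodular M X X Y₁ Y₂
  rw [Set.inter_self] at h
  exact le_of_add_le_right h

variable {M} in
lemma blockRank_le_of_rows_eq_zero [Finite I] {X X' : Set O} {Y : Set I}
    (h : ∀ y ∈ X, y ∉ X' → ∀ x ∈ Y, M y x = 0) : blockRank M X Y ≤ blockRank M X' Y :=
  calc blockRank M X Y
    _ ≤ blockRank M (X' ∪ X \ X') Y :=
        blockRank_mono M (by rw [Set.union_sdiff_self]; exact Set.subset_union_right) subset_rfl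
    _ ≤ blockRank M X' Y + blockRank M (X \ X') Y := blockRank_union_left_le M _ _ _
    _ = blockRank M X' Y := by
        rw [blockRank_eq_zero (X := X \ X') fun y hy => h y hy.1 hy.2, add_zero]

variable {M} in
lemma blockRank_le_of_cols_eq_zero [Finite I] {X : Set O} {Y Y' : Set I}
    (h : ∀ x ∈ Y, x ∉ Y' → ∀ y ∈ X, M y x = 0) : blockRank M X Y ≤ blockRank M X Y' :=
  calc blockRank M X Y
    _ ≤ blockRank M X (Y' ∪ Y \ Y') :=
        blockRank_mono M subset_rfl (by rw [Set.union_sdiff_self]; exact Set.subset_union_right)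
    _ ≤ blockRank M X Y' + blockRank M X (Y \ Y') := blockRank_union_right_le M _ _ _
    _ = blockRank M X Y' := by
        rw [blockRank_eq_zero (Y := Y \ Y') fun y hy x hx => h x hx.1 hx.2 y hy, add_zero]

variable {M} in
lemma blockRank_add_le_of_block_triangular [Finite I] {X₁ X₂ : Set O} {Y₁ Y₂ : Set I}
    (h : ∀ y ∈ X₁, ∀ x ∈ Y₂, M y x = 0) :
    blockRank M X₁ Y₁ + blockRank M X₂ Y₂ ≤ blockRank M (X₁ ∪ X₂) (Y₁ ∪ Y₂) := by
  have hsub := blockRank_submodular M (X₁ ∪ X₂) X₁ (Y₁ ∪ Y₂) Y₂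
  rw [blockRank_eq_zero h, add_zero, Set.inter_eq_right.2 Set.subset_union_right,
    Set.inter_eq_right.2 Set.subset_union_left] at hsub
  linarith [blockRank_mono M (Set.subset_union_right.trans Set.subset_union_left :
      X₂ ⊆ X₁ ∪ X₂ ∪ X₁) (subset_refl Y₂),
    blockRank_mono M (subset_refl X₁) (Set.subset_union_left.trans Set.subset_union_left :
      Y₁ ⊆ Y₁ ∪ Y₂ ∪ Y₂)]

variable {M} in
lemma blockRank_range_of_submatrix_eq_one {P : Type*} [Fintype P] [DecidableEq P] {f : P → O}
    {e : P → I} (h : M.submatrix f e = 1) :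
    blockRank M (.range f) (.range e) = Fintype.card P := by
  rw [← rank_submatrix_eq_blockRank, h, Matrix.rank_one]

end BlockRank

/-- A monotone submodular set function that grows by at most one with each element: the rank
function of a matroid up to an additive constant, which makes the notion stable under contraction
(`IsRankFun.union_left`). -/
structure IsRankFun {α : Type*} [DecidableEq α] (f : Finset α → ℕ) : Prop where
  le_insert : ∀ A e, f A ≤ f (insert e A)
  insert_le : ∀ A e, f (insert e A) ≤ f A + 1
  submodular : ∀ A B, f (A ∪ B) + f (A ∩ B) ≤ f A + f B

namespace IsRankFun

variable {α : Type*} [DecidableEq α] {f g : Finset α → ℕ}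

lemma monotone (hf : IsRankFun f) : Monotone f :=
  Finset.monotone_iff_forall_le_insert.2 fun A e _ => hf.le_insert A e

lemma union_le_add_card (hf : IsRankFun f) (A B : Finset α) : f (A ∪ B) ≤ f A + B.card := by
  induction B using Finset.induction_on with
  | empty => rw [Finset.union_empty, Finset.card_empty, add_zero]
  | insert e B he ih =>
    rw [Finset.union_insert, Finset.card_insert_of_notMem he]
    linarith [hf.insert_le (A ∪ B) e]

lemma union_left (hf : IsRankFun f) (C : Finset α) : IsRankFun fun A => f (C ∪ A) where
  le_insert A e := by
    rw [Finset.union_insert]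
    exact hf.le_insert _ _
  insert_le A e := by
    rw [Finset.union_insert]
    exact hf.insert_le _ _
  submodular A B := by
    rw [Finset.union_union_distrib_left, Finset.union_inter_distrib_left]
    exact hf.submodular _ _

lemma comp_map {β : Type*} [DecidableEq β] (hf : IsRankFun f) (i : β ↪ α) :
    IsRankFun fun A => f (A.map i) where
  le_insert A e := by
    rw [Finset.map_insert]
    exact hf.le_insert _ _
  insert_le A e := by
    rw [Finset.map_insert]
    exact hf.insert_le _ _
  submodular A B := by
    rw [Finset.map_union, Finset.map_inter]
    exact hf.submodular _ _

lemma union_le_of_forall_insert_le (hf : IsRankFun f) {B E : Finset α}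
    (h : ∀ e ∈ E, f (insert e B) ≤ f B) : f (B ∪ E) ≤ f B := by
  induction E using Finset.induction_on with
  | empty => rw [Finset.union_empty]
  | insert e E _ ih =>
    have hE := ih fun x hx => h x (Finset.mem_insert_of_mem hx)
    have he := h e (Finset.mem_insert_self _ _)
    have hsub := hf.submodular (B ∪ E) (insert e B)
    have hB : f B ≤ f ((B ∪ E) ∩ insert e B) := hf.monotone
      (Finset.subset_inter Finset.subset_union_left (Finset.subset_insert _ _))
    have hunion : B ∪ E ∪ insert e B = B ∪ insert e E := by grind
    rw [hunion] at hsub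
    linarith

lemma exists_subset_card (hf : IsRankFun f) (E : Finset α) {k : ℕ} (hk : f ∅ ≤ k) (hE : k ≤ f E) :
    ∃ B ⊆ E, f B = k ∧ B.card + f ∅ = k := by
  induction k, hk using Nat.le_induction with
  | base => exact ⟨∅, Finset.empty_subset _, rfl, by rw [Finset.card_empty, zero_add]⟩
  | succ k _ ih =>
    obtain ⟨B, hBE, hB, hcard⟩ := ih (by lia)
    obtain ⟨e, he, hlt⟩ : ∃ e ∈ E, f B < f (insert e B) := by
      by_contra! hle
      have hEB := hf.union_le_of_forall_insert_le hle
      rw [Finset.union_eq_right.2 hBE] at hEB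
      lia
    have heB : e ∉ B := fun h => by simp only [Finset.insert_eq_of_mem h, lt_irrefl] at hlt
    have hunit := hf.insert_le B e
    refine ⟨insert e B, Finset.insert_subset he hBE, by lia, ?_⟩
    rw [Finset.card_insert_of_notMem heB]
    lia

lemma singleton_eq_of_lt_insert (hf : IsRankFun f) {e : α} {A : Finset α}
    (h : f A < f (insert e A)) : f {e} = f ∅ + 1 := by
  have hsub := hf.submodular {e} A
  have hunit := hf.insert_le ∅ e
  have hmono : f ∅ ≤ f ({e} ∩ A) := hf.monotone (Finset.empty_subset _)
  rw [← Finset.insert_eq] at hsub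
  rw [insert_empty_eq] at hunit
  lia

/-- Uncrossing: if the min-max bound for `insert e E` fails once `e` is deleted, then it holds once
`e` is contracted. -/
lemma contract_bound (hf : IsRankFun f) (hg : IsRankFun g) {E U A : Finset α} {e : α} {c : ℕ}
    (he : e ∉ E) (h : ∀ A ⊆ insert e E, c ≤ f A + g (insert e E \ A)) (hU : U ⊆ E)
    (hlt : f U + g (E \ U) < c) (hA : A ⊆ E) :
    c + 1 ≤ f (insert e A) + g (insert e (E \ A)) := by
  have hmeet := h (U ∩ A) (by grind)
  have hjoin := h (U ∪ insert e A) (by grind)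
  have hf' := hf.submodular U (insert e A)
  have hg' := hg.submodular (E \ U) (insert e (E \ A))
  rw [show U ∩ insert e A = U ∩ A by grind] at hf'
  rw [show E \ U ∪ insert e (E \ A) = insert e E \ (U ∩ A) by grind,
    show E \ U ∩ insert e (E \ A) = insert e E \ (U ∪ insert e A) by grind] at hg'
  lia

/-- The matroid intersection theorem, by deletion and contraction of an element. -/
theorem exists_common_independent (hf : IsRankFun f) (hg : IsRankFun g) (E : Finset α) {k : ℕ}
    (h : ∀ A ⊆ E, k + f ∅ + g ∅ ≤ f A + g (E \ A)) :
    ∃ I ⊆ E, I.card = k ∧ k + f ∅ ≤ f I ∧ k + g ∅ ≤ g I := by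
  induction E using Finset.induction_on generalizing f g k with
  | empty =>
    have h₀ := h ∅ subset_rfl
    rw [Finset.sdiff_empty] at h₀
    exact ⟨∅, subset_rfl, by rw [Finset.card_empty]; lia, by lia, by lia⟩
  | insert e E he ih =>
    by_cases hdel : ∀ A ⊆ E, k + f ∅ + g ∅ ≤ f A + g (E \ A)
    · obtain ⟨I, hI, hI'⟩ := ih hf hg hdel
      exact ⟨I, hI.trans (Finset.subset_insert _ _), hI'⟩
    push Not at hdel
    obtain ⟨U, hU, hlt⟩ := hdel
    have hfe : f {e} = f ∅ + 1 := hf.singleton_eq_of_lt_insert (A := U) <| by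
      have hU' := h (insert e U) (Finset.insert_subset_insert _ hU)
      rw [show insert e E \ insert e U = E \ U by grind] at hU'
      lia
    have hge : g {e} = g ∅ + 1 := hg.singleton_eq_of_lt_insert (A := E \ U) <| by
      have hU' := h U (hU.trans (Finset.subset_insert _ _))
      rw [show insert e E \ U = insert e (E \ U) by grind] at hU'
      lia
    obtain ⟨m, rfl⟩ : ∃ m, k = m + 1 := Nat.exists_eq_succ_of_ne_zero fun hk => by
      have := hf.monotone (Finset.empty_subset U)
      have := hg.monotone (Finset.empty_subset (E \ U))
      lia
    obtain ⟨I, hI, hcard, hfI, hgI⟩ := ih (k := m) (hf.union_left {e}) (hg.union_left {e})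
      fun A hA => by
        have := hf.contract_bound hg he h hU hlt hA
        simp only [Finset.union_empty, ← Finset.insert_eq]
        lia
    rw [Finset.union_empty, ← Finset.insert_eq] at hfI hgI
    refine ⟨insert e I, Finset.insert_subset_insert _ hI, ?_, by lia, by lia⟩
    rw [Finset.card_insert_of_notMem fun heI => he (hI heI), hcard]

lemma iInf_of_submodular {ι : Type*} [Nonempty ι] [Max ι] [Min ι] {χ : ι → Finset α → ℕ}
    (le_insert : ∀ i A e, χ i A ≤ χ i (insert e A))
    (insert_le : ∀ i A e, χ i (insert e A) ≤ χ i A + 1)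
    (submodular : ∀ i j A B, χ (i ⊓ j) (A ∪ B) + χ (i ⊔ j) (A ∩ B) ≤ χ i A + χ j B) :
    IsRankFun fun A => ⨅ i, χ i A := by
  have hle (i A) : ⨅ i, χ i A ≤ χ i A := ciInf_le (OrderBot.bddBelow _) i
  have hex (A) : ∃ i, χ i A = ⨅ i, χ i A := ciInf_mem _
  refine ⟨fun A e => le_ciInf fun i => (hle i A).trans (le_insert i A e), fun A e => ?_,
    fun A B => ?_⟩
  · obtain ⟨i, hi⟩ := hex A
    rw [← hi]
    exact (hle i _).trans (insert_le i A e)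
  · obtain ⟨i, hi⟩ := hex A
    obtain ⟨j, hj⟩ := hex B
    rw [← hi, ← hj]
    exact (add_le_add (hle _ _) (hle _ _)).trans (submodular i j A B)

end IsRankFun

namespace LayeredNetwork

variable {V : Type*} {n : ℕ} (F : Type*) [Field F] (N : LayeredNetwork V n)

lemma incidence_eq_zero {y : OutPort V n} {x : InPort V n} (h : N.layer x.1 ≠ N.layer y.1 + 1) :
    N.toADT.incidence F y x = 0 :=
  if_neg fun hyx => h (N.layer_link y x hyx)

open Classical in
/-- The incidence matrix, bordered by identity matrices so that its rows and columns are indexed by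
all ports. The columns of a set of ports then record how these ports are fed, an input port through
its links or directly if it is the row itself, and an output port by itself. -/
noncomputable def portMatrix : Matrix (Port V n) (Port V n) F :=
  Matrix.fromBlocks 1 0 (N.toADT.incidence F) 1

lemma portMatrix_self (p : Port V n) : portMatrix F N p p = 1 := by
  rcases p with x | y <;> exact if_pos rfl

lemma portMatrix_inl_apply {x : InPort V n} {p : Port V n} (h : Sum.inl x ≠ p) :
    portMatrix F N (Sum.inl x) p = 0 := by
  rcases p with x' | y
  · exact if_neg fun hx => h (congrArg Sum.inl hx)
  · rfl

lemma portMatrix_apply_inr {p : Port V n} {y : OutPort V n} (h : p ≠ Sum.inr y) :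
    portMatrix F N p (Sum.inr y) = 0 := by
  rcases p with x | y'
  · rfl
  · exact if_neg fun hy => h (congrArg Sum.inr hy)

variable {N} in
lemma portMatrix_eq_zero {p p' : Port V n} (h : p ≠ p')
    (hl : N.layer p'.node ≠ N.layer p.node + 1) : portMatrix F N p p' = 0 := by
  rcases p with x | y
  · exact portMatrix_inl_apply F N h
  rcases p' with x' | y'
  · exact N.incidence_eq_zero F hl
  · exact portMatrix_apply_inr F N h

lemma blockRank_portMatrix (X : Set (OutPort V n)) (Y : Set (InPort V n)) :
    blockRank (portMatrix F N) (Sum.inr '' X) (Sum.inl '' Y) =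
      blockRank (N.toADT.incidence F) X Y :=
  (blockRank_submatrix (portMatrix F N) Sum.inr Sum.inl X Y).symm

variable {N} in
lemma ncard_le_blockRank_portMatrix [Finite V] {l : ℕ} {T : Set (Port V n)}
    (hT : ∀ p ∈ T, N.layer p.node = l) : T.ncard ≤ blockRank (portMatrix F N) T T := by
  classical
  have := Fintype.ofFinite T
  have hone : (portMatrix F N).submatrix Subtype.val Subtype.val = (1 : Matrix T T F) := by
    ext p p'
    rw [Matrix.submatrix_apply, Matrix.one_apply]
    split_ifs with h
    · rw [h, portMatrix_self]
    · exact portMatrix_eq_zero F (Subtype.coe_ne_coe.2 h) (by rw [hT _ p.2, hT _ p'.2]; lia)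
  have hrank := blockRank_range_of_submatrix_eq_one hone
  rw [Subtype.range_coe, ← Nat.card_eq_fintype_card, Nat.card_coe_set_eq] at hrank
  exact hrank.ge

/-- The ports through which `Ω` is fed or feeds others: the output ports of `Ω` and the input ports
of the source. -/
def cutPorts (Ω : Set V) : Set (Port V n) :=
  Sum.inl '' (Prod.fst ⁻¹' {N.source}) ∪ Sum.inr '' (Prod.fst ⁻¹' Ω)

variable {N} in
@[simp]
lemma inl_mem_cutPorts {Ω : Set V} {x : InPort V n} :
    Sum.inl x ∈ N.cutPorts Ω ↔ x.1 = N.source := by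
  simp [cutPorts]

variable {N} in
@[simp]
lemma inr_mem_cutPorts {Ω : Set V} {y : OutPort V n} : Sum.inr y ∈ N.cutPorts Ω ↔ y.1 ∈ Ω := by
  simp [cutPorts]

/-- The value of the cut `Ω` for the set `W` of ports. It bounds the rate at which the ports in `W`
can be fed when the input ports of the source are fed independently. -/
noncomputable def portCut (Ω : Set V) (W : Set (Port V n)) : ℕ :=
  blockRank (portMatrix F N) (N.cutPorts Ω) (Sum.inl '' (Prod.fst ⁻¹' Ωᶜ) ∪ W)

/-- The rate at which the ports in `W` can be fed jointly: the minimum of `portCut` over all cuts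
`Ω` that contain the source. -/
noncomputable def capacity (W : Finset (Port V n)) : ℕ :=
  ⨅ Ω : Set V, N.portCut F (insert N.source Ω) W

lemma portCut_submodular [Finite V] (Ω₁ Ω₂ : Set V) (W₁ W₂ : Set (Port V n)) :
    N.portCut F (Ω₁ ∩ Ω₂) (W₁ ∪ W₂) + N.portCut F (Ω₁ ∪ Ω₂) (W₁ ∩ W₂) ≤
      N.portCut F Ω₁ W₁ + N.portCut F Ω₂ W₂ := by
  refine le_trans (add_comm _ _ |>.trans_le (add_le_add (blockRank_mono _ ?_ ?_)
    (blockRank_mono _ ?_ ?_))) (blockRank_submodular _ _ _ _ _) <;>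
  · rintro (x | y) <;>
      simp only [Set.mem_union, Set.mem_inter_iff, Set.mem_image, Set.mem_preimage,
        Set.mem_compl_iff, inl_mem_cutPorts, inr_mem_cutPorts, Sum.inl.injEq, exists_eq_right,
        reduceCtorEq, and_false] <;>
      grind

lemma isRankFun_capacity [Finite V] [DecidableEq V] : IsRankFun (N.capacity F) := by
  refine IsRankFun.iInf_of_submodular (fun Ω A p => ?_) (fun Ω A p => ?_) fun Ω₁ Ω₂ A B => ?_
  · exact blockRank_mono _ subset_rfl
      (Set.union_subset_union_right _ (Finset.coe_subset.2 (Finset.subset_insert p A)))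
  · calc N.portCut F (insert N.source Ω) ↑(insert p A)
      _ = blockRank (portMatrix F N) (N.cutPorts (insert N.source Ω))
            (Sum.inl '' (Prod.fst ⁻¹' (insert N.source Ω)ᶜ) ∪ A ∪ {p}) := by
          rw [portCut, Finset.coe_insert, Set.union_insert, Set.union_singleton]
      _ ≤ N.portCut F (insert N.source Ω) A +
            blockRank (portMatrix F N) (N.cutPorts (insert N.source Ω)) {p} :=
          blockRank_union_right_le _ _ _ _
      _ ≤ N.portCut F (insert N.source Ω) A + 1 :=
          Nat.add_le_add_left ((blockRank_le_ncard_right _ _ _).trans_eq (Set.ncard_singleton p)) _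
  · have h := N.portCut_submodular F (insert N.source Ω₁) (insert N.source Ω₂) A B
    rwa [← Set.insert_inter_distrib, ← Set.insert_union_distrib, ← Finset.coe_union,
      ← Finset.coe_inter] at h

variable {F N}

lemma le_capacity_iff {R : ℕ} {W : Finset (Port V n)} :
    R ≤ N.capacity F W ↔ ∀ Ω, N.source ∈ Ω → R ≤ N.portCut F Ω W := by
  refine (le_ciInf_iff (OrderBot.bddBelow _)).trans ⟨fun h Ω hΩ => ?_, fun h Ω => ?_⟩
  · simpa only [Set.insert_eq_of_mem hΩ] using h Ω
  · exact h _ (Set.mem_insert _ _)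

lemma capacity_le_portCut {Ω : Set V} (hΩ : N.source ∈ Ω) (W : Finset (Port V n)) :
    N.capacity F W ≤ N.portCut F Ω W :=
  le_capacity_iff.1 le_rfl Ω hΩ

variable (F N) in
lemma capacity_empty : N.capacity F ∅ = 0 := by
  refine Nat.eq_zero_of_le_zero ((capacity_le_portCut (Set.mem_univ _) ∅).trans_eq ?_)
  refine blockRank_eq_zero fun p _ p' hp' => ?_
  simp at hp'

lemma capacity_le_card [Finite V] (W : Finset (Port V n)) : N.capacity F W ≤ W.card := by
  classical
  simpa [capacity_empty] using (N.isRankFun_capacity F).union_le_add_card ∅ W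

end LayeredNetwork

namespace ADTNetwork

variable {V I O F : Type*} [Field F] [Fintype I] (G : ADTNetwork V I O)

lemma cutRank_eq_blockRank [Finite O] (Ω : Set V) :
    G.cutRank F Ω = blockRank (G.incidence F) (G.outNode ⁻¹' Ω) (G.inNode ⁻¹' Ωᶜ) := by
  classical
  exact (rank_submatrix_eq_blockRank _ _ _).trans
    (congrArg₂ (blockRank (G.incidence F)) Subtype.range_coe Subtype.range_coe)

variable {G} in
lemma natCast_le_mincut_iff {S T : V} {R : ℕ} :
    (R : ℕ∞) ≤ G.mincut F S T ↔ ∀ Ω, S ∈ Ω → T ∉ Ω → R ≤ G.cutRank F Ω := by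
  simp only [mincut, le_iInf_iff, Subtype.forall, and_imp, Nat.cast_le]

end ADTNetwork

namespace LayeredNetwork

section VirtualSink

variable {V : Type*} {n : ℕ}

section Tapped

variable {W : Finset (Port V n)}

open Classical in
lemma layer_of_mem_tapped {N : LayeredNetwork V n} {l : ℕ} (hl : ∀ p ∈ W, N.layer p.node = l)
    {y : OutPort V n} (hy : y ∈ tapped W) : N.layer y.1 = l := by
  rcases hy with hy | hy
  · exact hl _ hy
  · obtain ⟨i, hi⟩ := Finset.card_pos.1 (Nat.zero_lt_of_lt hy)
    exact hl _ (Finset.mem_filter.1 hi).2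

open Classical in
lemma card_tapped_fiber (hnb : ∀ v i j, Sum.inl (v, i) ∈ W → Sum.inr (v, j) ∉ W) (v : V) :
    (Finset.univ.filter fun j : Fin n => (v, j) ∈ tapped W).card =
      (Finset.univ.filter fun i : Fin n => Sum.inl (v, i) ∈ W).card +
        (Finset.univ.filter fun j : Fin n => Sum.inr (v, j) ∈ W).card := by
  simp only [tapped, Set.mem_ofPred_eq]
  rcases (Finset.univ.filter fun i : Fin n => Sum.inl (v, i) ∈ W).eq_empty_or_nonempty with h | h
  · simp only [h, Finset.card_empty, not_lt_zero, or_false, zero_add]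
  · obtain ⟨i, hi⟩ := h
    have hout (j) : Sum.inr (v, j) ∉ W := hnb v i j (Finset.mem_filter.1 hi).2
    simp only [hout, false_or, Finset.filter_false, Finset.card_empty, add_zero,
      Fin.card_filter_val_lt]
    exact min_eq_right ((Finset.card_le_univ _).trans_eq (Fintype.card_fin n))

lemma ncard_tapped_inter [Finite V]
    (hnb : ∀ v i j, Sum.inl (v, i) ∈ W → Sum.inr (v, j) ∉ W) (Ω : Set V) :
    (tapped W ∩ Prod.fst ⁻¹' Ω).ncard = ((W : Set (Port V n)) ∩ Port.node ⁻¹' Ω).ncard := by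
  classical
  have := Fintype.ofFinite V
  simp only [Set.ncard_eq_toFinset_card', ← Set.filter_mem_univ_eq_toFinset, Finset.card_filter,
    Fintype.sum_sum_type, Fintype.sum_prod_type, ← Finset.sum_add_distrib, Set.mem_inter_iff,
    Set.mem_preimage, Finset.mem_coe]
  refine Finset.sum_congr rfl fun v _ => ?_
  by_cases hv : v ∈ Ω
  · simpa only [Port.node, Sum.elim_inl, Sum.elim_inr, hv, and_true, Finset.sum_add_distrib,
      Finset.card_filter] using card_tapped_fiber hnb v
  · simp only [Port.node, Sum.elim_inl, Sum.elim_inr, hv, and_false, if_false, add_zero]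

end Tapped

variable (F : Type*) [Field F] (N : LayeredNetwork V n) (W : Finset (Port V n))

lemma incidence_virtualSink_inl_of_mem {x : InPort V n} (hx : x ∈ disconnected W)
    (y : OutPort V n) : (N.virtualSink W).incidence F y (Sum.inl x) = 0 :=
  if_neg fun h => h.2 hx

lemma incidence_virtualSink_inl_of_notMem {x : InPort V n} (hx : x ∉ disconnected W)
    (y : OutPort V n) :
    (N.virtualSink W).incidence F y (Sum.inl x) = N.toADT.incidence F y x := by
  classical
  exact if_congr (and_iff_left hx) rfl rfl

variable {N W} in
lemma incidence_virtualSink_inr_of_ne {y : OutPort V n} {z : {y : OutPort V n // y ∈ tapped W}}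
    (h : y ≠ z) : (N.virtualSink W).incidence F y (Sum.inr z) = 0 :=
  if_neg h

lemma blockRank_virtualSink_inl (X : Set (OutPort V n)) {Y : Set (InPort V n)}
    (hY : ∀ x ∈ Y, x ∉ disconnected W) :
    blockRank ((N.virtualSink W).incidence F) X (Sum.inl '' Y) =
      blockRank (N.toADT.incidence F) X Y := by
  have himage := blockRank_submatrix ((N.virtualSink W).incidence F) id Sum.inl X Y
  rw [Set.image_id] at himage
  rw [← himage]
  exact blockRank_congr fun y _ x hx => N.incidence_virtualSink_inl_of_notMem F W (hY x hx) y

lemma blockRank_virtualSink_inr [Finite V] (X : Set (OutPort V n)) :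
    blockRank ((N.virtualSink W).incidence F) X (Set.range Sum.inr) = (tapped W ∩ X).ncard := by
  classical
  apply le_antisymm
  · refine (blockRank_le_of_rows_eq_zero (X' := tapped W ∩ X) ?_).trans
      (blockRank_le_ncard_left _ _ _)
    rintro y hy hyX _ ⟨z, rfl⟩
    exact incidence_virtualSink_inr_of_ne F fun hyz => hyX ⟨hyz ▸ z.2, hy⟩
  · have := Fintype.ofFinite ↥(tapped W ∩ X)
    have hone : ((N.virtualSink W).incidence F).submatrix Subtype.val
        (fun z : ↥(tapped W ∩ X) => Sum.inr ⟨z, z.2.1⟩) =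
        (1 : Matrix ↥(tapped W ∩ X) ↥(tapped W ∩ X) F) := by
      ext y z
      rw [Matrix.submatrix_apply, Matrix.one_apply]
      split_ifs with h
      · exact if_pos (congrArg Subtype.val h)
      · exact incidence_virtualSink_inr_of_ne F (Subtype.coe_ne_coe.2 h)
    rw [← Nat.card_coe_set_eq, Nat.card_eq_fintype_card, ← blockRank_range_of_submatrix_eq_one hone]
    exact blockRank_mono _ (by rw [Subtype.range_coe]; exact Set.inter_subset_right)
      (Set.range_subset_iff.2 fun z => ⟨_, rfl⟩)

/-- The value of the cut `Ω` for the virtual sink of a set `W` of ports of layer `l`, once the links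
leaving that layer have been discarded. It mediates between the cuts of the network with the
virtual sink and `portCut`, which do not correspond one to one. -/
noncomputable def sinkCut (l : ℕ) (Ω : Set V) : ℕ :=
  blockRank (N.toADT.incidence F) (Prod.fst ⁻¹' Ω)
      {x | N.layer x.1 ≤ l ∧ x.1 ∉ Ω ∧ x ∉ disconnected W} +
    ((W : Set (Port V n)) ∩ Port.node ⁻¹' Ω).ncard

variable {N W} {l : ℕ} [Finite V]

lemma cutRank_virtualSink_le_sinkCut [Fintype (InPort V n ⊕ {y : OutPort V n // y ∈ tapped W})]
    (hl : ∀ p ∈ W, N.layer p.node = l)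
    (hnb : ∀ v i j, Sum.inl (v, i) ∈ W → Sum.inr (v, j) ∉ W) (Ω : Set V) :
    (N.virtualSink W).cutRank F (some '' (Ω ∪ {v | l < N.layer v})) ≤ N.sinkCut F W l Ω := by
  set Y : Set (InPort V n) := {x | N.layer x.1 ≤ l ∧ x.1 ∉ Ω ∧ x ∉ disconnected W}
  set M := (N.virtualSink W).incidence F
  set X : Set (OutPort V n) := Prod.fst ⁻¹' (Ω ∪ {v | l < N.layer v})
  have hrows : (N.virtualSink W).outNode ⁻¹' (some '' (Ω ∪ {v | l < N.layer v})) = X :=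
    Set.ext fun y => (Option.some_injective V).mem_set_image
  rw [ADTNetwork.cutRank_eq_blockRank, hrows, sinkCut, ← ncard_tapped_inter hnb]
  calc blockRank M X ((N.virtualSink W).inNode ⁻¹' (some '' (Ω ∪ {v | l < N.layer v}))ᶜ)
    _ ≤ blockRank M X (Sum.inl '' Y ∪ Set.range Sum.inr) := by
        refine blockRank_le_of_cols_eq_zero ?_
        rintro (x | z) hx hxY y _
        · refine N.incidence_virtualSink_inl_of_mem F W (not_not.1 fun hd => hxY ?_) y
          exact .inl ⟨x, ⟨not_lt.1 fun h => hx ⟨x.1, .inr h, rfl⟩,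
            fun h => hx ⟨x.1, .inl h, rfl⟩, hd⟩, rfl⟩
        · exact absurd (.inr ⟨z, rfl⟩) hxY
    _ ≤ blockRank (N.toADT.incidence F) X Y + (tapped W ∩ X).ncard := by
        rw [← N.blockRank_virtualSink_inl F W X fun x hx => hx.2.2,
          ← N.blockRank_virtualSink_inr F W X]
        exact blockRank_union_right_le _ _ _ _
    _ ≤ _ := by
        refine add_le_add (blockRank_le_of_rows_eq_zero ?_) (Set.ncard_le_ncard ?_ (Set.toFinite _))
        · rintro y (hy | hy : y.1 ∈ Ω ∨ l < N.layer y.1) hyΩ x hx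
          · exact absurd hy hyΩ
          · exact N.incidence_eq_zero F (by have := hx.1; lia)
        · rintro y ⟨hyW, hy | hy : y.1 ∈ Ω ∨ l < N.layer y.1⟩
          · exact ⟨hyW, hy⟩
          · exact absurd (layer_of_mem_tapped hl hyW) hy.ne'

lemma sinkCut_le_cutRank_virtualSink [Fintype (InPort V n ⊕ {y : OutPort V n // y ∈ tapped W})]
    (hl : ∀ p ∈ W, N.layer p.node = l)
    (hnb : ∀ v i j, Sum.inl (v, i) ∈ W → Sum.inr (v, j) ∉ W) {Ω : Set (Option V)}
    (hΩ : none ∉ Ω) :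
    N.sinkCut F W l (some ⁻¹' Ω) ≤ (N.virtualSink W).cutRank F Ω := by
  set Y : Set (InPort V n) := {x | N.layer x.1 ≤ l ∧ x.1 ∉ some ⁻¹' Ω ∧ x ∉ disconnected W}
  set X : Set (OutPort V n) := Prod.fst ⁻¹' (some ⁻¹' Ω)
  set X₁ : Set (OutPort V n) := {y ∈ X | N.layer y.1 < l}
  set M := (N.virtualSink W).incidence F
  rw [ADTNetwork.cutRank_eq_blockRank, sinkCut, ← ncard_tapped_inter hnb]
  calc blockRank (N.toADT.incidence F) X Y + (tapped W ∩ X).ncard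
    _ ≤ blockRank (N.toADT.incidence F) X₁ Y + (tapped W ∩ X).ncard := by
        refine Nat.add_le_add_right (blockRank_le_of_rows_eq_zero fun y hy hy₁ x hx => ?_) _
        exact N.incidence_eq_zero F fun h => hy₁ ⟨hy, by have := hx.1; lia⟩
    _ = blockRank M X₁ (Sum.inl '' Y) + blockRank M X (Set.range Sum.inr) := by
        rw [N.blockRank_virtualSink_inl F W X₁ fun x hx => hx.2.2,
          N.blockRank_virtualSink_inr F W X]
    _ ≤ blockRank M (X₁ ∪ X) (Sum.inl '' Y ∪ Set.range Sum.inr) := by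
        refine blockRank_add_le_of_block_triangular ?_
        rintro y hy _ ⟨z, rfl⟩
        exact incidence_virtualSink_inr_of_ne F fun hyz =>
          hy.2.ne (layer_of_mem_tapped hl (hyz ▸ z.2))
    _ ≤ blockRank M X ((N.virtualSink W).inNode ⁻¹' Ωᶜ) := by
        refine blockRank_mono _ (Set.union_subset (Set.sep_subset _ _) subset_rfl) ?_
        rintro _ (⟨x, hx, rfl⟩ | ⟨z, rfl⟩)
        · exact hx.2.1
        · exact hΩ

end VirtualSink

section Regular

variable {V : Type*} {n : ℕ} (F : Type*) [Field F] {N : LayeredNetwork V n}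
  {W : Finset (Port V n)} {l : ℕ}

lemma portCut_le_sinkCut [Finite V] (hl : ∀ p ∈ W, N.layer p.node = l)
    (hnb : ∀ v i j, Sum.inl (v, i) ∈ W → Sum.inr (v, j) ∉ W) {Ω : Set V} (hΩ : N.source ∈ Ω) :
    N.portCut F (Ω ∪ {v | l < N.layer v} ∪ {v | ∃ i, Sum.inl (v, i) ∈ W}) W ≤
      N.sinkCut F W l Ω := by
  set Ω' : Set V := Ω ∪ {v | l < N.layer v} ∪ {v | ∃ i, Sum.inl (v, i) ∈ W}
  set Y : Set (InPort V n) := {x | N.layer x.1 ≤ l ∧ x.1 ∉ Ω ∧ x ∉ disconnected W}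
  set T : Set (Port V n) := ↑W ∩ Port.node ⁻¹' Ω
  calc N.portCut F Ω' W
    _ ≤ blockRank (portMatrix F N) (N.cutPorts Ω') (Sum.inl '' Y ∪ T) := by
        refine blockRank_le_of_cols_eq_zero fun p hp hpY p' hp' => ?_
        rcases hp with ⟨x, hx, rfl⟩ | hp
        · refine absurd (.inl ⟨x, ⟨not_lt.1 fun h => hx (.inl (.inr h)),
            fun h => hx (.inl (.inl h)), fun h => hx (.inr h.2)⟩, rfl⟩) hpY
        have hpΩ : p.node ∉ Ω := fun h => hpY (.inr ⟨hp, h⟩)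
        rcases p with x | y
        · exact absurd (.inl ⟨x, ⟨(hl _ hp).le, hpΩ, fun h => h.1 hp⟩, rfl⟩) hpY
        · refine portMatrix_apply_inr F N ?_
          rintro rfl
          rcases inr_mem_cutPorts.1 hp' with (h | h) | ⟨i, hi⟩
          · exact hpΩ h
          · exact absurd (hl _ hp) (ne_of_gt h)
          · exact hnb _ _ _ hi hp
    _ ≤ blockRank (portMatrix F N) (N.cutPorts Ω') (Sum.inl '' Y) +
          blockRank (portMatrix F N) (N.cutPorts Ω') T := blockRank_union_right_le _ _ _ _
    _ ≤ blockRank (portMatrix F N) (Sum.inr '' (Prod.fst ⁻¹' Ω)) (Sum.inl '' Y) + T.ncard := by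
        refine add_le_add (blockRank_le_of_rows_eq_zero ?_) (blockRank_le_ncard_right _ _ _)
        rintro (x' | y) hy hyΩ _ ⟨x, ⟨hxl, hxΩ, -⟩, rfl⟩
        · exact portMatrix_inl_apply F N (by rintro ⟨⟩; exact hxΩ (inl_mem_cutPorts.1 hy ▸ hΩ))
        · refine N.incidence_eq_zero F ?_
          rcases inr_mem_cutPorts.1 hy with (h | h) | ⟨i, hi⟩
          · exact absurd ⟨y, h, rfl⟩ hyΩ
          · have : l < N.layer y.1 := h
            lia
          · have : N.layer y.1 = l := hl _ hi
            lia
    _ = N.sinkCut F W l Ω := by rw [blockRank_portMatrix, sinkCut]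

lemma sinkCut_le_portCut [Finite V] (hl : ∀ p ∈ W, N.layer p.node = l) (Ω : Set V) :
    N.sinkCut F W l {v ∈ Ω | v = N.source ∨ ∀ i, Sum.inl (v, i) ∉ W} ≤ N.portCut F Ω W := by
  set Ω' : Set V := {v ∈ Ω | v = N.source ∨ ∀ i, Sum.inl (v, i) ∉ W}
  set X : Set (OutPort V n) := {y | y.1 ∈ Ω' ∧ N.layer y.1 < l}
  set Y : Set (InPort V n) := {x | N.layer x.1 ≤ l ∧ x.1 ∉ Ω' ∧ x ∉ disconnected W}
  set T : Set (Port V n) := ↑W ∩ Port.node ⁻¹' Ω'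
  have hsource {x : InPort V n} (hx : Sum.inl x ∈ T) : x.1 = N.source :=
    hx.2.2.resolve_right fun h => h x.2 hx.1
  calc N.sinkCut F W l Ω'
    _ ≤ blockRank (N.toADT.incidence F) X Y + T.ncard := by
        refine Nat.add_le_add_right (blockRank_le_of_rows_eq_zero fun y hy hyX x hx => ?_) _
        exact N.incidence_eq_zero F fun h => hyX ⟨hy, by have := hx.1; lia⟩
    _ ≤ blockRank (portMatrix F N) (Sum.inr '' X) (Sum.inl '' Y) +
          blockRank (portMatrix F N) T T := by
        rw [blockRank_portMatrix]
        exact Nat.add_le_add_left (ncard_le_blockRank_portMatrix F fun p hp => hl p hp.1) _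
    _ ≤ blockRank (portMatrix F N) (Sum.inr '' X ∪ T) (Sum.inl '' Y ∪ T) := by
        refine blockRank_add_le_of_block_triangular ?_
        rintro _ ⟨y, hy, rfl⟩ (x | y') hp
        · refine N.incidence_eq_zero F ?_
          have := hl _ hp.1
          have := N.layer_pos y.1
          rw [hsource hp, N.layer_source]
          lia
        · refine portMatrix_apply_inr F N ?_
          rintro ⟨⟩
          exact hy.2.ne (hl _ hp.1)
    _ ≤ N.portCut F Ω W := by
        refine blockRank_mono _ (Set.union_subset ?_ ?_) (Set.union_subset ?_ ?_)
        · exact Set.image_subset_iff.2 fun y hy => inr_mem_cutPorts.2 hy.1.1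
        · rintro (x | y) hp
          · exact inl_mem_cutPorts.2 (hsource hp)
          · exact inr_mem_cutPorts.2 hp.2.1
        · rintro _ ⟨x, ⟨-, hxΩ, hxW⟩, rfl⟩
          by_cases hx : x.1 ∈ Ω
          · refine .inr (not_not.1 fun hxn => hxΩ ⟨hx, .inr fun i hi => hxW ⟨hxn, i, hi⟩⟩)
          · exact .inl ⟨x, hx, rfl⟩
        · exact fun p hp => .inr hp.1

variable {F}

theorem mincut_virtualSink_eq_capacity [Finite V]
    [Fintype (InPort V n ⊕ {y : OutPort V n // y ∈ tapped W})]
    (hl : ∀ p ∈ W, N.layer p.node = l)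
    (hnb : ∀ v i j, Sum.inl (v, i) ∈ W → Sum.inr (v, j) ∉ W) :
    (N.virtualSink W).mincut F (some N.source) none = N.capacity F W := by
  refine ENat.eq_of_forall_natCast_le_iff fun R => ?_
  rw [ADTNetwork.natCast_le_mincut_iff, Nat.cast_le, le_capacity_iff]
  constructor
  · intro h Ω hΩ
    refine (h _ ?_ ?_).trans ((cutRank_virtualSink_le_sinkCut F hl hnb _).trans
      (sinkCut_le_portCut F hl Ω))
    · exact ⟨N.source, .inl ⟨hΩ, .inl rfl⟩, rfl⟩
    · rintro ⟨v, -, ⟨⟩⟩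
  · intro h Ω hΩ hΩn
    exact (h _ (.inl (.inl hΩ))).trans ((portCut_le_sinkCut F hl hnb hΩ).trans
      (sinkCut_le_cutRank_virtualSink F hl hnb hΩn))

theorem isRegular_iff [Fintype V] {R : ℕ} (hl : ∀ p ∈ W, N.layer p.node = l)
    (hnb : ∀ v i j, Sum.inl (v, i) ∈ W → Sum.inr (v, j) ∉ W) :
    N.IsRegular F R W ↔ W.card = R ∧ R ≤ N.capacity F W := by
  classical
  refine ⟨fun h => ⟨h.card_eq, ?_⟩, fun h => ⟨h.1, ⟨l, hl⟩, hnb, ?_⟩⟩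
  · exact Nat.cast_le.1 (h.mincut_eq.ge.trans_eq (mincut_virtualSink_eq_capacity hl hnb))
  · rw [mincut_virtualSink_eq_capacity hl hnb, Nat.cast_inj]
    exact le_antisymm ((capacity_le_card W).trans_eq h.1) h.2

lemma IsRegular.le_capacity [Fintype V] {R : ℕ} (h : N.IsRegular F R W) : R ≤ N.capacity F W := by
  obtain ⟨l, hl⟩ := h.same_layer
  exact ((isRegular_iff hl h.not_both).1 h).2

end Regular

section RegularOutputs

variable {V : Type*} {n : ℕ} (F : Type*) [Field F] {N : LayeredNetwork V n}

lemma isRankFun_blockRank [Finite V] [DecidableEq (OutPort V n)] (Y : Set (InPort V n)) :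
    IsRankFun fun A : Finset (OutPort V n) => blockRank (N.toADT.incidence F) A Y where
  le_insert A y := blockRank_mono _ (Finset.coe_subset.2 (Finset.subset_insert y A)) subset_rfl
  insert_le A y := by
    rw [Finset.coe_insert, ← Set.union_singleton]
    exact (blockRank_union_left_le _ _ _ _).trans (Nat.add_le_add_left
      ((blockRank_le_ncard_left _ _ _).trans_eq (Set.ncard_singleton y)) _)
  submodular A B := by
    have h := blockRank_submodular (N.toADT.incidence F) (A : Set (OutPort V n)) B Y Y
    rwa [Set.inter_self, Set.union_self, ← Finset.coe_union, ← Finset.coe_inter] at h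

/-- The ports of `N.cutPorts Ω` other than the output ports of layer `l` and beyond. -/
def cutPortsBelow (N : LayeredNetwork V n) (l : ℕ) (Ω : Set V) : Set (Port V n) :=
  {p ∈ N.cutPorts Ω | ∀ y, p = Sum.inr y → N.layer y.1 < l}

lemma blockRank_cutPortsBelow_add_ncard_le_portCut [Finite V] {l : ℕ} {C : Set (OutPort V n)}
    (hC : ∀ y ∈ C, N.layer y.1 = l) (Ω : Set V) :
    blockRank (portMatrix F N) (N.cutPortsBelow l Ω) (Sum.inl '' (Prod.fst ⁻¹' Ωᶜ)) +
        (C ∩ Prod.fst ⁻¹' Ω).ncard ≤ N.portCut F Ω (Sum.inr '' C) := by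
  set T : Set (Port V n) := Sum.inr '' (C ∩ Prod.fst ⁻¹' Ω)
  have hT : T.ncard ≤ blockRank (portMatrix F N) T T :=
    ncard_le_blockRank_portMatrix F (Set.forall_mem_image.2 fun y hy => hC y hy.1)
  rw [Set.ncard_image_of_injective _ Sum.inr_injective] at hT
  refine (Nat.add_le_add_left hT _).trans ((blockRank_add_le_of_block_triangular ?_).trans
    (blockRank_mono _ (Set.union_subset (Set.sep_subset _ _) ?_)
      (Set.union_subset_union_right _ (Set.image_mono Set.inter_subset_left))))
  · rintro p hp _ ⟨y, hy, rfl⟩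
    exact portMatrix_apply_inr F N fun h => (hp.2 y h).ne (hC y hy.1)
  · exact Set.image_subset_iff.2 fun y hy => inr_mem_cutPorts.2 hy.2

variable (N) in
lemma blockRank_cutPorts_union_le_cutPortsBelow [Finite V] (l : ℕ) (Ω : Set V) :
    blockRank (portMatrix F N) (N.cutPorts (Ω ∪ {v | l < N.layer v}))
        (Sum.inl '' (Prod.fst ⁻¹' (Ω ∪ {v | l < N.layer v})ᶜ)) ≤
      blockRank (portMatrix F N) (N.cutPortsBelow l Ω) (Sum.inl '' (Prod.fst ⁻¹' Ωᶜ)) := by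
  refine (blockRank_le_of_rows_eq_zero ?_).trans (blockRank_mono _ subset_rfl
    (Set.image_mono (Set.preimage_mono (Set.compl_subset_compl.2 Set.subset_union_left))))
  rintro (x' | y) hp hpX _ ⟨x, hx, rfl⟩
  · exact absurd ⟨inl_mem_cutPorts.2 (inl_mem_cutPorts.1 hp), nofun⟩ hpX
  · refine N.incidence_eq_zero F fun h => ?_
    have hxl : N.layer x.1 ≤ l := not_lt.1 fun h => hx (.inr h)
    rcases inr_mem_cutPorts.1 hp with hy | (hy : l < N.layer y.1)
    · exact hpX ⟨inr_mem_cutPorts.2 hy, by rintro _ ⟨⟩; lia⟩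
    · lia

section

variable {l : ℕ} {W' : Set (InPort V n)} {A C : Set (OutPort V n)}

lemma blockRank_cutPorts_union_le_blockRank_incidence [Finite V] (hl : 1 ≤ l)
    (hW' : ∀ x ∈ W', N.layer x.1 = l + 1) (hAC : ∀ y, N.layer y.1 = l → y ∈ A ∪ C) (Ω : Set V) :
    blockRank (portMatrix F N) (N.cutPorts (Ω ∪ {v | l < N.layer v})) (Sum.inl '' W') ≤
      blockRank (N.toADT.incidence F) (A ∪ C ∩ Prod.fst ⁻¹' Ω) W' := by
  rw [← blockRank_portMatrix]
  refine blockRank_le_of_rows_eq_zero ?_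
  rintro (x' | y) hp hpA _ ⟨x, hx, rfl⟩
  · refine portMatrix_inl_apply F N ?_
    rintro ⟨⟩
    have h := hW' _ hx
    rw [inl_mem_cutPorts.1 hp, N.layer_source] at h
    lia
  · refine N.incidence_eq_zero F fun h => ?_
    have hyl : N.layer y.1 = l := by have := hW' x hx; lia
    have hyΩ : y.1 ∈ Ω := (inr_mem_cutPorts.1 hp).resolve_right fun h => hyl.not_gt h
    exact hpA ⟨y, (hAC y hyl).imp_right fun hyC => ⟨hyC, hyΩ⟩, rfl⟩

lemma portCut_inl_le_blockRank_add_portCut_inr [Finite V] (hl : 1 ≤ l)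
    (hW' : ∀ x ∈ W', N.layer x.1 = l + 1) (hC : ∀ y ∈ C, N.layer y.1 = l)
    (hAC : ∀ y, N.layer y.1 = l → y ∈ A ∪ C) (Ω : Set V) :
    N.portCut F (Ω ∪ {v | l < N.layer v}) (Sum.inl '' W') ≤
      blockRank (N.toADT.incidence F) A W' + N.portCut F Ω (Sum.inr '' C) := by
  set Ω' : Set V := Ω ∪ {v | l < N.layer v}
  set T : Set (OutPort V n) := C ∩ Prod.fst ⁻¹' Ω
  set r := blockRank (portMatrix F N) (N.cutPortsBelow l Ω) (Sum.inl '' (Prod.fst ⁻¹' Ωᶜ))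
  calc N.portCut F Ω' (Sum.inl '' W')
    _ ≤ blockRank (portMatrix F N) (N.cutPorts Ω') (Sum.inl '' (Prod.fst ⁻¹' Ω'ᶜ)) +
          blockRank (portMatrix F N) (N.cutPorts Ω') (Sum.inl '' W') :=
        blockRank_union_right_le _ _ _ _
    _ ≤ r + blockRank (N.toADT.incidence F) (A ∪ T) W' :=
        add_le_add (N.blockRank_cutPorts_union_le_cutPortsBelow F l Ω)
          (blockRank_cutPorts_union_le_blockRank_incidence F hl hW' hAC Ω)
    _ ≤ r + (blockRank (N.toADT.incidence F) A W' + T.ncard) :=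
        Nat.add_le_add_left ((blockRank_union_left_le _ _ _ _).trans
          (Nat.add_le_add_left (blockRank_le_ncard_left _ _ _) _)) _
    _ ≤ blockRank (N.toADT.incidence F) A W' + N.portCut F Ω (Sum.inr '' C) := by
        linarith [blockRank_cutPortsBelow_add_ncard_le_portCut F hC Ω]

end

variable {F}

lemma capacity_map_inl_le [Finite V] {l : ℕ} (hl : 1 ≤ l) {W' : Finset (InPort V n)}
    (hW' : ∀ x ∈ W', N.layer x.1 = l + 1) {A : Set (OutPort V n)} {C : Finset (OutPort V n)}
    (hC : ∀ y ∈ C, N.layer y.1 = l) (hAC : ∀ y, N.layer y.1 = l → y ∈ A ∪ C) :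
    N.capacity F (W'.map .inl) ≤
      blockRank (N.toADT.incidence F) A W' + N.capacity F (C.map .inr) := by
  rw [← Nat.sub_le_iff_le_add', le_capacity_iff]
  intro Ω hΩ
  have hcap := capacity_le_portCut (F := F) (Ω := Ω ∪ {v | l < N.layer v}) (.inl hΩ) (W'.map .inl)
  rw [Finset.coe_map] at hcap
  rw [Nat.sub_le_iff_le_add', Finset.coe_map]
  exact hcap.trans (portCut_inl_le_blockRank_add_portCut_inr F hl hW' hC hAC Ω)

theorem exists_regular_outputs [Fintype V] {l R : ℕ} (hl : 1 ≤ l) {W' : Finset (InPort V n)}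
    (hW' : ∀ x ∈ W', N.layer x.1 = l + 1) (hreg : N.IsRegular F R (W'.map .inl)) :
    ∃ W : Finset (OutPort V n), (∀ y ∈ W, N.layer y.1 = l) ∧ N.IsRegular F R (W.map .inr) ∧
      ((N.toADT.incidence F).submatrix (fun y : {y // y ∈ W} => y.1)
        (fun x : {x // x ∈ W'} => x.1)).rank = R := by
  classical
  set L : Finset (OutPort V n) := Finset.univ.filter fun y => N.layer y.1 = l
  have hL {y} : y ∈ L ↔ N.layer y.1 = l := by simp [L]
  have hempty : blockRank (N.toADT.incidence F) ↑(∅ : Finset (OutPort V n)) W' = 0 :=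
    blockRank_eq_zero fun y hy => absurd hy (Finset.notMem_empty y)
  have hcut (A) (_ : A ⊆ L) : R ≤ blockRank (N.toADT.incidence F) A W' +
      N.capacity F ((L \ A).map .inr) :=
    hreg.le_capacity.trans (capacity_map_inl_le hl hW' (fun y hy => hL.1 (Finset.mem_sdiff.1 hy).1)
      fun y hy => or_iff_not_imp_left.2 fun hyA => Finset.mem_sdiff.2 ⟨hL.2 hy, hyA⟩)
  obtain ⟨W, hWL, hcard, hrank, hcap⟩ :=
    (isRankFun_blockRank F (N := N) W').exists_common_independent
      ((N.isRankFun_capacity F).comp_map .inr) L (k := R) (by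
        simpa only [hempty, Finset.map_empty, capacity_empty, add_zero] using hcut)
  rw [hempty, add_zero] at hrank
  rw [Finset.map_empty, capacity_empty, add_zero] at hcap
  have hW : ∀ y ∈ W, N.layer y.1 = l := fun y hy => hL.1 (hWL hy)
  refine ⟨W, hW, (isRegular_iff (l := l) ?_ ?_).2 ⟨(Finset.card_map _).trans hcard, hcap⟩, ?_⟩
  · exact Finset.forall_mem_map.2 hW
  · simp
  · refine le_antisymm ((Matrix.rank_le_card_height _).trans_eq
      ((Fintype.card_coe W).trans hcard)) (hrank.trans_eq ?_)
    rw [rank_submatrix_eq_blockRank]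
    exact (congrArg₂ _ Subtype.range_coe Subtype.range_coe).symm

end RegularOutputs

section Reroute

variable {V : Type*} {n : ℕ}

/-- The `i`-th input port of `v`, as an embedding, so that sets of input ports of `v` are images of
sets of indices. -/
def inputPort (v : V) : Fin n ↪ Port V n :=
  (Function.Embedding.sectR v (Fin n)).trans .inl

variable [DecidableEq V]

/-- Replaces the ports `p` of `v` by input ports of `v`, with indices `h p`, and keeps the other
ports. -/
def reroute (v : V) (h : Port V n → Fin n) (p : Port V n) : Port V n :=
  if p.node = v then inputPort v (h p) else p

lemma image_reroute (v : V) (h : Port V n → Fin n) (W : Finset (Port V n)) :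
    W.image (reroute v h) = W.filter (fun p => p.node ≠ v) ∪
      ((W.filter fun p => p.node = v).image h).map (inputPort v) := by
  ext p
  simp only [reroute, Finset.mem_image, Finset.mem_union, Finset.mem_filter, Finset.mem_map]
  grind

end Reroute

section Exchange

variable {V : Type*} {n R : ℕ} {F : Type*} [Field F] {N : LayeredNetwork V n}

lemma le_capacity_inputs [Fintype V] {v : V} (hv : v ≠ N.source)
    (hcut : (R : ℕ∞) ≤ N.toADT.mincut F N.source v) :
    R ≤ N.capacity F (Finset.univ.map (inputPort v)) := by
  rw [ADTNetwork.natCast_le_mincut_iff] at hcut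
  rw [le_capacity_iff]
  intro Ω hΩ
  refine (hcut (Ω \ {v}) ⟨hΩ, hv.symm⟩ fun h => h.2 rfl).trans ?_
  rw [ADTNetwork.cutRank_eq_blockRank, ← blockRank_portMatrix]
  refine blockRank_mono _ (Set.image_subset_iff.2 fun y hy => inr_mem_cutPorts.2 hy.1)
    (Set.image_subset_iff.2 fun x hx => ?_)
  by_cases hxv : x.1 = v
  · exact .inr (Finset.mem_coe.2 (Finset.mem_map.2 ⟨x.2, Finset.mem_univ _, hxv ▸ rfl⟩))
  · exact .inl ⟨x, fun h => hx ⟨h, hxv⟩, rfl⟩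

theorem exists_regular_inputs [Fintype V] {v : V} (hv : v ≠ N.source)
    (hcut : (R : ℕ∞) ≤ N.toADT.mincut F N.source v) :
    ∃ I : Finset (Fin n), N.IsRegular F R (I.map (inputPort v)) := by
  classical
  obtain ⟨I, -, hcap, hcard⟩ := ((N.isRankFun_capacity F).comp_map (inputPort v)).exists_subset_card
    Finset.univ (k := R) (by simp [capacity_empty]) (le_capacity_inputs hv hcut)
  rw [Finset.map_empty, capacity_empty, add_zero] at hcard
  refine ⟨I, (isRegular_iff (l := N.layer v) ?_ ?_).2 ⟨(Finset.card_map _).trans hcard, hcap.ge⟩⟩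
  · exact Finset.forall_mem_map.2 fun i _ => rfl
  · intro u i j _ hj
    simp [inputPort] at hj

lemma capacity_le_capacity_union_inputs [Finite V] [DecidableEq V] {v : V} (hv : v ≠ N.source)
    (W : Finset (Port V n)) :
    N.capacity F W ≤
      N.capacity F (W.filter (fun p => p.node ≠ v) ∪ Finset.univ.map (inputPort v)) := by
  refine le_capacity_iff.2 fun Ω hΩ => ?_
  refine (capacity_le_portCut (Ω := Ω \ {v}) ⟨hΩ, hv.symm⟩ W).trans ?_
  refine (blockRank_le_of_cols_eq_zero fun p hp hpY p' hp' => ?_).trans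
    (blockRank_mono _ (Set.union_subset_union_right _
      (Set.image_mono (Set.preimage_mono Set.sdiff_subset))) subset_rfl)
  rcases p with x | y
  · refine absurd ?_ hpY
    by_cases hx : x.1 = v
    · exact .inr (Finset.mem_coe.2 (Finset.mem_union_right _
        (Finset.mem_map.2 ⟨x.2, Finset.mem_univ _, hx ▸ rfl⟩)))
    · rcases hp with ⟨_, hxΩ, ⟨⟩⟩ | hxW
      · exact .inl ⟨x, fun h => hxΩ ⟨h, hx⟩, rfl⟩
      · exact .inr (Finset.mem_coe.2 (Finset.mem_union_left _ (Finset.mem_filter.2 ⟨hxW, hx⟩)))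
  · have hyW : Sum.inr y ∈ W := hp.resolve_left (by rintro ⟨_, _, ⟨⟩⟩)
    refine portMatrix_apply_inr F N ?_
    rintro rfl
    exact hpY (.inr (Finset.mem_coe.2 (Finset.mem_union_left _
      (Finset.mem_filter.2 ⟨hyW, (inr_mem_cutPorts.1 hp').2⟩))))

lemma exists_exchange_of_ne_source [Finite V] [DecidableEq V] {v : V} (hv : v ≠ N.source)
    {W : Finset (Port V n)} (hW : W.card ≤ N.capacity F W) :
    ∃ I : Finset (Fin n), I.card = (W.filter fun p => p.node = v).card ∧
      W.card ≤ N.capacity F (W.filter (fun p => p.node ≠ v) ∪ I.map (inputPort v)) := by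
  set W₀ := W.filter fun p => p.node ≠ v
  set W₁ := W.filter fun p => p.node = v
  have hcard : W₁.card + W₀.card = W.card := Finset.card_filter_add_card_filter_not _
  have hf : IsRankFun fun I : Finset (Fin n) => N.capacity F (W₀ ∪ I.map (inputPort v)) :=
    ((N.isRankFun_capacity F).union_left W₀).comp_map _
  have hle : N.capacity F W₀ ≤ W₀.card := capacity_le_card W₀
  have hge : N.capacity F W ≤ N.capacity F W₀ + W₁.card := by
    have h := (N.isRankFun_capacity F).union_le_add_card W₀ W₁
    rwa [Finset.union_comm, Finset.filter_union_filter_not_eq] at h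
  obtain ⟨I, -, hI, hIcard⟩ := hf.exists_subset_card Finset.univ (k := W.card)
    (by rw [Finset.map_empty, Finset.union_empty]; lia)
    (hW.trans (capacity_le_capacity_union_inputs hv W))
  rw [Finset.map_empty, Finset.union_empty] at hIcard
  exact ⟨I, by lia, hI.ge⟩

lemma capacity_le_card_filter_source [Finite V] [DecidableEq V] {W : Finset (Port V n)}
    (hl : ∀ p ∈ W, N.layer p.node = 1) :
    N.capacity F W ≤ (W.filter fun p => p.node = N.source).card := by
  refine (capacity_le_portCut (Ω := {v | v = N.source ∨ 1 < N.layer v}) (.inl rfl) W).trans ?_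
  rw [← Set.ncard_coe_finset]
  refine (blockRank_le_of_cols_eq_zero fun p hp hpS p' hp' => ?_).trans
    (blockRank_le_ncard_right _ _ _)
  have hsource : p.node ≠ N.source := fun h => hpS (Finset.mem_coe.2
    (Finset.mem_filter.2 ⟨hp.resolve_left (by rintro ⟨x, hx, rfl⟩; exact hx (.inl h)), h⟩))
  have hlayer : N.layer p.node ≤ 1 := by
    rcases hp with ⟨x, hx, rfl⟩ | hp
    · exact not_lt.1 fun h => hx (.inr h)
    · exact (hl p hp).le
  refine portMatrix_eq_zero F ?_ ?_
  · rintro rfl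
    rcases p' with x | y
    · exact hsource (inl_mem_cutPorts.1 hp')
    · exact (inr_mem_cutPorts.1 hp').elim hsource hlayer.not_gt
  · have := N.layer_pos p'.node
    lia

variable (F N) in
lemma card_le_capacity_map_inputPort_source [Finite V] (I : Finset (Fin n)) :
    I.card ≤ N.capacity F (I.map (inputPort N.source)) := by
  refine le_capacity_iff.2 fun Ω _ => ?_
  have hT : ∀ p ∈ I.map (inputPort N.source), p.node = N.source :=
    Finset.forall_mem_map.2 fun i _ => rfl
  rw [← Finset.card_map (inputPort N.source), ← Set.ncard_coe_finset]
  refine (ncard_le_blockRank_portMatrix F (l := 1) fun p hp => ?_).trans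
    (blockRank_mono _ ?_ Set.subset_union_right)
  · rw [hT p hp, N.layer_source]
  · rw [Finset.coe_map]
    rintro _ ⟨i, -, rfl⟩
    exact inl_mem_cutPorts.2 rfl

lemma exists_exchange_source [Finite V] [DecidableEq V] {W : Finset (Port V n)}
    (hW : W.card ≤ N.capacity F W) (hl : ∀ p ∈ W, N.layer p.node = 1)
    (hin : ∀ i, Sum.inl (N.source, i) ∉ W) :
    ∃ I : Finset (Fin n), I.card = (W.filter fun p => p.node = N.source).card ∧
      W.card ≤ N.capacity F (W.filter (fun p => p.node ≠ N.source) ∪ I.map (inputPort N.source)) ∧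
      ∀ i ∈ I, (i : ℕ) < W.card := by
  set W₁ := W.filter fun p => p.node = N.source
  have hcard : W₁.card = W.card :=
    le_antisymm (Finset.card_filter_le _ _) (hW.trans (capacity_le_card_filter_source hl))
  have houtputs : W₁ ⊆ Finset.univ.image fun j => Sum.inr (N.source, j) := by
    rintro (⟨u, i⟩ | ⟨u, j⟩) hp <;> obtain ⟨hp, rfl : u = N.source⟩ := Finset.mem_filter.1 hp
    · exact absurd hp (hin i)
    · exact Finset.mem_image.2 ⟨j, Finset.mem_univ _, rfl⟩
  have hn : W.card ≤ n := by
    simpa only [hcard, Finset.card_univ, Fintype.card_fin] using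
      (Finset.card_le_card houtputs).trans Finset.card_image_le
  set I : Finset (Fin n) := Finset.univ.filter fun i => (i : ℕ) < W.card
  have hI : I.card = W.card := Fin.card_filter_val_lt.trans (min_eq_right hn)
  refine ⟨I, hI.trans hcard.symm, ?_, fun i hi => (Finset.mem_filter.1 hi).2⟩
  calc W.card
    _ = I.card := hI.symm
    _ ≤ N.capacity F (I.map (inputPort N.source)) := card_le_capacity_map_inputPort_source F N I
    _ ≤ _ := (N.isRankFun_capacity F).monotone Finset.subset_union_right

lemma IsRegular.exchange [Fintype V] [DecidableEq V] {v : V} {W : Finset (Port V n)}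
    (hW : N.IsRegular F R W) (hl : ∀ p ∈ W, N.layer p.node = N.layer v) {I : Finset (Fin n)}
    (hI : I.card = (W.filter fun p => p.node = v).card)
    (hcap : R ≤ N.capacity F (W.filter (fun p => p.node ≠ v) ∪ I.map (inputPort v))) :
    N.IsRegular F R (W.filter (fun p => p.node ≠ v) ∪ I.map (inputPort v)) := by
  have hnode : ∀ p ∈ I.map (inputPort v), p.node = v := Finset.forall_mem_map.2 fun i _ => rfl
  refine (isRegular_iff (l := N.layer v) ?_ ?_).2 ⟨?_, hcap⟩
  · intro p hp
    rcases Finset.mem_union.1 hp with hp | hp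
    · exact hl p (Finset.mem_filter.1 hp).1
    · rw [hnode p hp]
  · simp only [Finset.mem_union]
    rintro u i j (hi | hi) (hj | hj)
    · exact hW.not_both u i j (Finset.mem_filter.1 hi).1 (Finset.mem_filter.1 hj).1
    · simp [inputPort] at hj
    · exact (Finset.mem_filter.1 hj).2 (hnode (Sum.inl (u, i)) hi)
    · simp [inputPort] at hj
  · have hdisj : Disjoint (W.filter fun p => p.node ≠ v) (I.map (inputPort v)) :=
      Finset.disjoint_left.2 fun p hp hpI => (Finset.mem_filter.1 hp).2 (hnode p hpI)
    rw [Finset.card_union_of_disjoint hdisj, Finset.card_map, hI, add_comm,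
      Finset.card_filter_add_card_filter_not, hW.card_eq]

theorem exists_isRegular_reroute [Fintype V] [DecidableEq V] {v : V} {W : Finset (Port V n)}
    (hW : N.IsRegular F R W) (hl : ∀ p ∈ W, N.layer p.node = N.layer v)
    (hin : ∀ i, Sum.inl (v, i) ∉ W) :
    ∃ h : Port V n → Fin n, N.IsRegular F R (W.image (reroute v h)) ∧
      (v = N.source → ∀ p ∈ W, p.node = v → (h p : ℕ) < R) := by
  set W₁ := W.filter fun p => p.node = v
  have hle : W.card ≤ N.capacity F W := hW.card_eq.trans_le hW.le_capacity
  obtain ⟨I, hI, hcap, hIR⟩ : ∃ I : Finset (Fin n), I.card = W₁.card ∧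
      W.card ≤ N.capacity F (W.filter (fun p => p.node ≠ v) ∪ I.map (inputPort v)) ∧
      (v = N.source → ∀ i ∈ I, (i : ℕ) < W.card) := by
    rcases eq_or_ne v N.source with rfl | hv
    · simpa only [true_imp_iff] using
        exists_exchange_source hle (by simpa only [N.layer_source] using hl) hin
    · simpa only [hv, false_imp_iff, and_true] using exists_exchange_of_ne_source hv hle
  obtain ⟨h, hh⟩ : ∃ h : Port V n → Fin n, W₁.image h = I := by
    rcases isEmpty_or_nonempty (Fin n)
    · exact ⟨Sum.elim Prod.snd Prod.snd, Subsingleton.elim _ _⟩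
    · obtain ⟨h, hh⟩ := W₁.finite_toSet.exists_bijOn_of_encard_eq (t := (I : Set (Fin n))) (by
        simp only [Set.encard_coe_eq_coe_finsetCard, hI])
      exact ⟨h, Finset.coe_injective (by rw [Finset.coe_image, hh.image_eq])⟩
  rw [hW.card_eq] at hcap hIR
  refine ⟨h, ?_, fun hv p hp hpv => hIR hv _
    (hh ▸ Finset.mem_image_of_mem h (Finset.mem_filter.2 ⟨hp, hpv⟩))⟩
  rw [image_reroute, hh]
  exact hW.exchange hl hI hcap

end Exchange

end LayeredNetwork

theorem exists_forall_notMem_of_subsingleton {ι F : Type*} {S : Set ι} {B : ι → Set F}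
    (hB : ∀ i ∈ S, (B i).Subsingleton) (hcard : S.encard < ENat.card F) :
    ∃ t, ∀ i ∈ S, t ∉ B i := by
  by_contra! hbad
  choose i hiS hi using hbad
  have hinj : Function.Injective fun t => (⟨i t, hiS t⟩ : S) := fun t t' h =>
    hB _ (hiS t) (hi t) (by rw [Subtype.mk.inj h]; exact hi t')
  exact (ENat.card_le_card_of_injective hinj).not_gt hcard

theorem exists_forall_of_subsingleton_lines {ι σ F : Type*} [Finite σ] [DecidableEq σ]
    {S : Set ι} {P : ι → (σ → F) → Prop}
    (hline : ∀ i ∈ S, ∀ z s, P i z → {t | ¬ P i (Function.update z s t)}.Subsingleton)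
    (hne : ∀ i ∈ S, ∃ z, P i z) (hcard : S.encard < ENat.card F) :
    ∃ z, ∀ i ∈ S, P i z := by
  classical
  have := Fintype.ofFinite σ
  have : Nonempty F := (ENat.card_ne_zero_iff_nonempty F).1 (pos_of_gt hcard).ne'
  suffices hpartial : ∀ T : Finset σ, ∃ z : σ → F, ∀ i ∈ S, ∃ w, (∀ s ∈ T, w s = z s) ∧ P i w by
    obtain ⟨z, hz⟩ := hpartial Finset.univ
    refine ⟨z, fun i hi => ?_⟩
    obtain ⟨w, hwz, hw⟩ := hz i hi
    rwa [← funext fun s => hwz s (Finset.mem_univ s)]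
  intro T
  induction T using Finset.induction_on with
  | empty => exact ⟨Classical.arbitrary _, fun i hi => (hne i hi).imp fun w hw => ⟨by simp, hw⟩⟩
  | insert s T hs ih =>
    obtain ⟨z, hz⟩ := ih
    choose! w hwz hw using hz
    obtain ⟨t, ht⟩ := exists_forall_notMem_of_subsingleton
      (fun i hi => hline i hi (w i) s (hw i hi)) hcard
    refine ⟨Function.update z s t, fun i hi =>
      ⟨Function.update (w i) s t, fun a ha => ?_, not_not.1 (ht i hi)⟩⟩
    obtain rfl | has := eq_or_ne a s
    · rw [Function.update_self, Function.update_self]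
    · rw [Function.update_of_ne has, Function.update_of_ne has]
      exact hwz i hi a (Finset.mem_of_mem_insert_of_ne ha has)

theorem subsingleton_not_linearIndependent_add_smul {ι F M : Type*} [Finite ι] [Field F]
    [AddCommGroup M] [Module F M] {v : ι → M} (hv : LinearIndependent F v) (c : ι → F) (u : M) :
    {t | ¬ LinearIndependent F fun i => v i + (t * c i) • u}.Subsingleton := by
  have := Fintype.ofFinite ι
  have hcoord : ∀ t, ¬ LinearIndependent F (fun i => v i + (t * c i) • u) →
      ∃ h : ι → F, ∑ i, h i • v i = u ∧ t * ∑ i, h i * c i = -1 := by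
    intro t ht
    obtain ⟨g, hg, i, hgi⟩ := Fintype.not_linearIndependent_iff.1 ht
    have hsum : ∑ i, g i • v i = -(t * ∑ i, g i * c i) • u := by
      rw [neg_smul, eq_neg_iff_add_eq_zero, ← hg, Finset.mul_sum, Finset.sum_smul,
        ← Finset.sum_add_distrib]
      refine Finset.sum_congr rfl fun i _ => ?_
      rw [smul_add, smul_smul, mul_left_comm]
    have hκ : t * ∑ i, g i * c i ≠ 0 := fun h0 =>
      hgi (Fintype.linearIndependent_iff.1 hv g (by rw [hsum, h0, neg_zero, zero_smul]) i)
    refine ⟨fun i => (-(t * ∑ i, g i * c i))⁻¹ * g i, ?_, ?_⟩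
    · simp only [mul_smul, ← Finset.smul_sum, hsum]
      rw [inv_smul_smul₀ (neg_ne_zero.2 hκ)]
    · simp only [mul_assoc, ← Finset.mul_sum]
      rw [mul_left_comm, inv_neg, neg_mul, inv_mul_cancel₀ hκ]
  intro t ht t' ht'
  obtain ⟨h, hu, hc⟩ := hcoord t ht
  obtain ⟨h', hu', hc'⟩ := hcoord t' ht'
  obtain rfl : h = h' := hv.fintypeLinearCombination_injective (hu.trans hu'.symm)
  refine mul_right_cancel₀ (right_ne_zero_of_mul (a := t) ?_) (hc.trans hc'.symm)
  rw [hc]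
  exact neg_ne_zero.2 one_ne_zero

theorem exists_forall_linearIndepOn {σ α F M : Type*} [Fintype σ] [Field F] [AddCommGroup M]
    [Module F M] {S : Set (Finset α)} (hcard : S.encard < ENat.card F) (a : α → M)
    (c : σ → α → F) (u : σ → M)
    (hne : ∀ W ∈ S, ∃ z : σ → F, LinearIndepOn F (fun p => a p + ∑ s, (z s * c s p) • u s) W) :
    ∃ z : σ → F, ∀ W ∈ S, LinearIndepOn F (fun p => a p + ∑ s, (z s * c s p) • u s) W := by
  classical
  refine exists_forall_of_subsingleton_lines (fun W _ z s hz => ?_) hne hcard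
  have hupdate : ∀ t p, a p + ∑ r, (Function.update z s t r * c r p) • u r =
      (a p + ∑ r, (z r * c r p) • u r) + ((t - z s) * c s p) • u s := by
    intro t p
    rw [add_assoc, ← Finset.add_sum_erase _ _ (Finset.mem_univ s),
      ← Finset.add_sum_erase _ (fun r => (z r * c r p) • u r) (Finset.mem_univ s),
      Function.update_self, add_right_comm, ← add_smul, sub_mul, add_sub_cancel]
    congr 2
    refine Finset.sum_congr rfl fun r hr => ?_
    rw [Function.update_of_ne (Finset.ne_of_mem_erase hr)]
  simp only [hupdate]
  exact (subsingleton_not_linearIndependent_add_smul hz (fun p => c s p) (u s)).preimage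
    (sub_left_injective (b := z s))

lemma linearIndependent_row_of_rank_eq_card {ι κ F : Type*} [Fintype ι] [Fintype κ] [Field F]
    {A : Matrix ι κ F} (hA : A.rank = Fintype.card ι) : LinearIndependent F A.row :=
  linearIndependent_iff_card_eq_finrank_span.2 (hA.symm.trans A.rank_eq_finrank_span_row)

lemma linearIndependent_sum_smul_of_rank_eq_card {ι κ F M : Type*} [Fintype ι] [Fintype κ] [Field F]
    [AddCommGroup M] [Module F M] {A : Matrix ι κ F} (hA : A.rank = Fintype.card κ) {v : ι → M}
    (hv : LinearIndependent F v) : LinearIndependent F fun j => ∑ i, A i j • v i :=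
  (linearIndependent_row_of_rank_eq_card (A.rank_transpose.trans hA)).map_injOn
    (Fintype.linearCombination F v) hv.fintypeLinearCombination_injective.injOn

namespace LayeredNetwork

section Coefficients

variable {V : Type*} {n R l Nlayer : ℕ} {N : LayeredNetwork V n}

lemma exists_map_inl_eq {W : Finset (Port V n)} (hW : ∀ p ∈ W, p ∈ N.layerInputs l) :
    ∃ W' : Finset (InPort V n), W'.map .inl = W := by
  refine ⟨W.toLeft, Finset.ext fun p => ?_⟩
  rcases p with x | y
  · simp
  · simpa using fun hy => by obtain ⟨_, -, ⟨⟩⟩ := hW _ hy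

lemma mem_frontier_of_insert {D : Set V} {v : V} {p : Port V n}
    (hp : p ∈ N.frontier R l (insert v D)) (hpv : p.node ≠ v) : p ∈ N.frontier R l D := by
  obtain ⟨hl, hD⟩ := hp
  refine ⟨hl, ?_⟩
  rcases p with x | y
  · exact ⟨fun h => hD.1 (.inr h), hD.2⟩
  · exact hD.resolve_left hpv

variable {F : Type*} [Field F]

lemma recode_eq_sum {M : Type*} [AddCommGroup M] [Module F M] [DecidableEq V] (v : V)
    (b : Fin n → Fin n → F) (x : InPort V n → M) (y : OutPort V n → M) (w : OutPort V n) :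
    recode v b x y w = (if w.1 = v then 0 else y w) +
      ∑ s : Fin n × Fin n, (b s.1 s.2 * if w = (v, s.2) then 1 else 0) • x (v, s.1) := by
  obtain ⟨w, j⟩ := w
  by_cases hw : w = v
  · simp [recode, hw, Fintype.sum_prod_type]
  · simp [recode, hw]

lemma recode_eq_input {M : Type*} [AddCommGroup M] [Module F M] (v : V) (h : Fin n → Fin n)
    (x : InPort V n → M) (y : OutPort V n → M) (j : Fin n) :
    recode v (fun i j => if i = h j then (1 : F) else 0) x y (v, j) = x (v, h j) := by
  simp [recode]

lemma exists_link_of_rank_eq_card {W : Finset (OutPort V n)} {W' : Finset (InPort V n)}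
    (hrank : ((N.toADT.incidence F).submatrix (fun y : {y // y ∈ W} => y.1)
      (fun x : {x // x ∈ W'} => x.1)).rank = W.card) {y : OutPort V n} (hy : y ∈ W) :
    ∃ x, N.link y x := by
  by_contra! hno
  have hrow := linearIndependent_row_of_rank_eq_card (hrank.trans (Fintype.card_coe W).symm)
  exact hrow.ne_zero ⟨y, hy⟩ (by funext x; exact if_neg (hno x.1))

lemma ncard_le_mul [Finite V] (hN : {v | N.layer v = l}.ncard ≤ Nlayer) {Q : Set (Port V n)}
    (hl : ∀ p ∈ Q, N.layer p.node = l) (hQ : ∀ x, Sum.inl x ∈ Q → Sum.inr x ∉ Q) :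
    Q.ncard ≤ n * Nlayer := by
  have hmaps : ∀ p ∈ Q, Sum.elim id id p ∈ {v | N.layer v = l} ×ˢ (Set.univ : Set (Fin n)) := by
    rintro (x | y) hp <;> exact ⟨hl _ hp, trivial⟩
  have hinj : Q.InjOn (Sum.elim id id) := by
    rintro (x | y) hp (x' | y') hp' (rfl : _ = _)
    · rfl
    · exact absurd hp' (hQ _ hp)
    · exact absurd hp (hQ _ hp')
    · rfl
  calc Q.ncard
    _ ≤ ({v | N.layer v = l} ×ˢ (Set.univ : Set (Fin n))).ncard :=
        Set.ncard_le_ncard_of_injOn _ hmaps hinj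
    _ = {v | N.layer v = l}.ncard * n := by
        rw [Set.ncard_prod, Set.ncard_univ, Nat.card_eq_fintype_card, Fintype.card_fin]
    _ ≤ n * Nlayer := by rw [mul_comm]; exact Nat.mul_le_mul_left n hN

variable [Fintype V]

theorem encard_setOf_isRegular_le (hN : {v | N.layer v = l}.ncard ≤ Nlayer) {Q : Set (Port V n)}
    (hl : ∀ p ∈ Q, N.layer p.node = l) (hQ : ∀ x, Sum.inl x ∈ Q → Sum.inr x ∉ Q) :
    {W : Finset (Port V n) | (∀ p ∈ W, p ∈ Q) ∧ N.IsRegular F R W}.encard ≤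
      ((n * Nlayer).choose R : ℕ) := by
  classical
  have hsub : {W : Finset (Port V n) | (∀ p ∈ W, p ∈ Q) ∧ N.IsRegular F R W} ⊆
      (Q.toFinset.powersetCard R : Set (Finset (Port V n))) := fun W hW =>
    Finset.mem_coe.2 (Finset.mem_powersetCard.2
      ⟨fun p hp => Set.mem_toFinset.2 (hW.1 p hp), hW.2.card_eq⟩)
  refine (Set.encard_le_encard hsub).trans ?_
  rw [Set.encard_coe_eq_coe_finsetCard, Finset.card_powersetCard, ← Set.ncard_eq_toFinset_card',
    Nat.cast_le]
  exact Nat.choose_le_choose R (ncard_le_mul hN hl hQ)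

theorem exists_forall_isRegular_linearIndepOn {σ M : Type*} [Fintype σ] [AddCommGroup M]
    [Module F M] (hN : {v | N.layer v = l}.ncard ≤ Nlayer)
    (hF : ((n * Nlayer).choose R : ℕ∞) < ENat.card F) {Q : Set (Port V n)}
    (hl : ∀ p ∈ Q, N.layer p.node = l) (hQ : ∀ x, Sum.inl x ∈ Q → Sum.inr x ∉ Q)
    {f : (σ → F) → Port V n → M} (a : Port V n → M) (c : σ → Port V n → F) (u : σ → M)
    (hf : ∀ z p, f z p = a p + ∑ s, (z s * c s p) • u s)
    (hne : ∀ W : Finset (Port V n), (∀ p ∈ W, p ∈ Q) → N.IsRegular F R W →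
      ∃ z, LinearIndepOn F (f z) W) :
    ∃ z, ∀ W : Finset (Port V n), (∀ p ∈ W, p ∈ Q) → N.IsRegular F R W →
      LinearIndepOn F (f z) W := by
  obtain rfl : f = fun z p => a p + ∑ s, (z s * c s p) • u s := funext₂ hf
  obtain ⟨z, hz⟩ := exists_forall_linearIndepOn
    ((encard_setOf_isRegular_le (R := R) (F := F) hN hl hQ).trans_lt hF) a c u
    fun W hW => hne W hW.1 hW.2
  exact ⟨z, fun W hWQ hW => hz W ⟨hWQ, hW⟩⟩

lemma received_eq_sum_incidence {M : Type*} [AddCommGroup M] [Module F M] (k : OutPort V n → F)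
    (y : OutPort V n → M) (x : InPort V n) :
    N.received k y x = ∑ w, (k w * N.toADT.incidence F w x) • y w := by
  rw [received, Finset.sum_filter]
  refine Finset.sum_congr rfl fun w _ => ?_
  by_cases hw : N.link w x <;> simp [ADTNetwork.incidence, toADT, hw]

lemma received_indicator {M : Type*} [AddCommGroup M] [Module F M] (W : Finset (OutPort V n))
    (y : OutPort V n → M) (x : InPort V n) :
    N.received (Set.indicator (W : Set (OutPort V n)) (1 : OutPort V n → F)) y x =
      ∑ w : W, N.toADT.incidence F w x • y w := by
  classical
  rw [received_eq_sum_incidence, Finset.sum_coe_sort W fun w => N.toADT.incidence F w x • y w,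
    ← Finset.sum_indicator_subset _ (Finset.subset_univ W)]
  refine Finset.sum_congr rfl fun w _ => ?_
  by_cases hw : w ∈ W <;> simp [hw]

lemma invariant_iff {Q : Set (Port V n)} {x : InPort V n → Fin R → F}
    {y : OutPort V n → Fin R → F} :
    N.Invariant R Q x y ↔ ∀ W : Finset (Port V n), (∀ p ∈ W, p ∈ Q) → N.IsRegular F R W →
      LinearIndepOn F (Sum.elim x y) (W : Set (Port V n)) :=
  Iff.rfl

lemma exists_linearIndepOn_received (hl : 1 ≤ l) {x : InPort V n → Fin R → F}
    {y : OutPort V n → Fin R → F} (hinv : N.Invariant R (N.linkedOutputs l) x y)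
    {W' : Finset (InPort V n)} (hW' : ∀ x ∈ W', N.layer x.1 = l + 1)
    (hreg : N.IsRegular F R (W'.map .inl)) :
    ∃ k : OutPort V n → F, LinearIndepOn F (N.received k y) W' := by
  obtain ⟨W, hWl, hW, hrank⟩ := exists_regular_outputs hl hW' hreg
  have hWcard : W.card = R := (Finset.card_map _).symm.trans hW.card_eq
  have hW'card : W'.card = R := (Finset.card_map _).symm.trans hreg.card_eq
  have hlinked : ∀ p ∈ W.map .inr, p ∈ N.linkedOutputs l := Finset.forall_mem_map.2 fun w hw =>
    ⟨w, hWl w hw, exists_link_of_rank_eq_card (hrank.trans hWcard.symm) hw, rfl⟩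
  have hindep : LinearIndepOn F (Sum.elim x y) (Sum.inr '' (W : Set (OutPort V n))) :=
    Finset.coe_map Function.Embedding.inr W ▸ invariant_iff.1 hinv _ hlinked hW
  have hy : LinearIndependent F fun w : W => y w := hindep.comp_of_image Sum.inr_injective.injOn
  refine ⟨Set.indicator W 1, ?_⟩
  rw [LinearIndepOn, funext fun x : (W' : Set (InPort V n)) => received_indicator W y x.1]
  exact linearIndependent_sum_smul_of_rank_eq_card
    (hrank.trans (hW'card.symm.trans (Fintype.card_coe W').symm)) hy

theorem exists_virtual_coefficients (hN : {v | N.layer v = l + 1}.ncard ≤ Nlayer)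
    (hF : ((n * Nlayer).choose R : ℕ∞) < ENat.card F) (hl : 1 ≤ l)
    {x : InPort V n → Fin R → F} {y : OutPort V n → Fin R → F}
    (hinv : N.Invariant R (N.linkedOutputs l) x y) :
    ∃ k : OutPort V n → F, N.Invariant R (N.layerInputs (l + 1)) (N.received k y) y := by
  refine exists_forall_isRegular_linearIndepOn hN hF (by rintro _ ⟨x, hx, rfl⟩; exact hx)
    (by rintro x - ⟨_, -, ⟨⟩⟩) (f := fun k => Sum.elim (N.received k y) y) (Sum.elim 0 y)
    (fun w => Sum.elim (N.toADT.incidence F w) 0) y (fun k p => ?_) fun W hW hreg => ?_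
  · rcases p with x | w
    · simp only [Sum.elim_inl, Pi.zero_apply, zero_add, received_eq_sum_incidence]
    · simp only [Sum.elim_inr, Pi.zero_apply, mul_zero, zero_smul, Finset.sum_const_zero, add_zero]
  · obtain ⟨W', rfl⟩ := exists_map_inl_eq hW
    have hl' : ∀ x ∈ W', N.layer x.1 = l + 1 := fun x hx => by
      obtain ⟨_, hx', ⟨⟩⟩ := hW _ (Finset.mem_map_of_mem _ hx)
      exact hx'
    obtain ⟨k, hk⟩ := exists_linearIndepOn_received hl hinv hl' hreg
    refine ⟨k, ?_⟩
    rw [Finset.coe_map]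
    exact LinearIndepOn.image_of_comp Sum.inl _ hk

lemma exists_linearIndepOn_recode {D : Set V} {v : V} (hv : N.layer v = l) (hvD : v ∉ D)
    {x : InPort V n → Fin R → F} {y : OutPort V n → Fin R → F}
    (hinv : N.Invariant R (N.frontier R l D) x y) {W : Finset (Port V n)}
    (hWQ : ∀ p ∈ W, p ∈ N.frontier R l (insert v D)) (hW : N.IsRegular F R W) :
    ∃ b : Fin n → Fin n → F, LinearIndepOn F (Sum.elim x (recode v b x y)) W := by
  classical
  have hvW : ∀ i, Sum.inl (v, i) ∉ W := fun i hi => (hWQ _ hi).2.1 (.inl rfl)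
  obtain ⟨h, hreg, hsource⟩ := exists_isRegular_reroute hW
    (fun p hp => (hWQ p hp).1.trans hv.symm) hvW
  have hQ : ∀ p ∈ W.image (reroute v h), p ∈ N.frontier R l D := by
    refine Finset.forall_mem_image.2 fun p hp => ?_
    by_cases hpv : p.node = v
    · rw [reroute, if_pos hpv]
      exact ⟨hv, hvD, fun hvs => hsource hvs p hp hpv⟩
    · rw [reroute, if_neg hpv]
      exact mem_frontier_of_insert (hWQ p hp) hpv
  have hinj : Set.InjOn (reroute v h) W :=
    Finset.card_image_iff.1 (hreg.card_eq.trans hW.card_eq.symm)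
  have hindep := invariant_iff.1 hinv _ hQ hreg
  rw [Finset.coe_image] at hindep
  refine ⟨fun i j => if i = h (Sum.inr (v, j)) then 1 else 0,
    (linearIndepOn_congr fun p hp => ?_).1 (hindep.comp_of_image hinj)⟩
  by_cases hpv : Port.node p = v
  · obtain ⟨w, i⟩ | ⟨w, j⟩ := p
    · obtain rfl : w = v := hpv
      exact absurd hp (hvW i)
    · obtain rfl : w = v := hpv
      rw [Function.comp_apply, reroute, if_pos (show Port.node (.inr (w, j)) = w from rfl)]
      exact (recode_eq_input w (fun j => h (Sum.inr (w, j))) x y j).symm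
  · rw [Function.comp_apply, reroute, if_neg hpv]
    rcases p with p | p
    · rfl
    · exact (if_neg hpv).symm

theorem exists_internal_coefficients (hN : {v | N.layer v = l}.ncard ≤ Nlayer)
    (hF : ((n * Nlayer).choose R : ℕ∞) < ENat.card F) {D : Set V} {v : V} (hv : N.layer v = l)
    (hvD : v ∉ D) {x : InPort V n → Fin R → F} {y : OutPort V n → Fin R → F}
    (hinv : N.Invariant R (N.frontier R l D) x y) :
    ∃ b : Fin n → Fin n → F, N.Invariant R (N.frontier R l (insert v D)) x (recode v b x y) := by
  classical
  suffices h : ∃ b : Fin n × Fin n → F,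
      N.Invariant R (N.frontier R l (insert v D)) x (recode v (fun i j => b (i, j)) x y) from
    let ⟨b, hb⟩ := h; ⟨fun i j => b (i, j), hb⟩
  refine exists_forall_isRegular_linearIndepOn hN hF
    (fun p hp => hp.1) (fun p (hp : _ ∈ N.frontier R l (insert v D)) hp' => hp.2.1 hp'.2)
    (f := fun b : Fin n × Fin n → F => Sum.elim x (recode v (fun i j => b (i, j)) x y))
    (Sum.elim x fun w => if w.1 = v then 0 else y w)
    (fun s => Sum.elim (fun _ => 0) fun w => if w = (v, s.2) then 1 else 0) (fun s => x (v, s.1))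
    (fun b p => ?_) fun W hWQ hW => ?_
  · rcases p with p | w
    · simp only [Sum.elim_inl, mul_zero, zero_smul, Finset.sum_const_zero, add_zero]
    · exact recode_eq_sum v (fun i j => b (i, j)) x y w
  · obtain ⟨b, hb⟩ := exists_linearIndepOn_recode hv hvD hinv hWQ hW
    exact ⟨fun s => b s.1 s.2, hb⟩

end Coefficients

section Code

variable {V : Type*} {n R l Nlayer : ℕ} {F : Type*} [Field F] {N : LayeredNetwork V n}

/-- The values on the output ports when every supernode `v` combines the values on its input ports
with the internal coefficients `β v`. -/
def encode {M : Type*} [AddCommGroup M] [Module F M] (β : V → Fin n → Fin n → F)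
    (x : InPort V n → M) : OutPort V n → M :=
  fun p => ∑ i, β p.1 i p.2 • x (p.1, i)

lemma encode_update {M : Type*} [AddCommGroup M] [Module F M] [DecidableEq V]
    (β : V → Fin n → Fin n → F) (v : V) (b : Fin n → Fin n → F) (x : InPort V n → M) :
    encode (Function.update β v b) x = recode v b x (encode β x) := by
  funext p
  by_cases hp : p.1 = v
  · rw [recode, if_pos hp, encode, hp, Function.update_self]
  · rw [recode, if_neg hp, encode, encode, Function.update_of_ne hp]

section InitialSegment

variable [LinearOrder V] {D E : Set V} {a : V}

/-- The initial segments of layer `l`, which are the sets of supernodes already coded when the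
supernodes of the layer are processed in increasing order. -/
def IsInitialSegment (N : LayeredNetwork V n) (l : ℕ) (D : Set V) : Prop :=
  (∀ v ∈ D, N.layer v = l) ∧ ∀ v ∈ D, ∀ w, N.layer w = l → w ≤ v → w ∈ D

lemma isInitialSegment_empty : N.IsInitialSegment l ∅ :=
  ⟨fun _ h => absurd h (Set.notMem_empty _), fun _ h => absurd h (Set.notMem_empty _)⟩

lemma isInitialSegment_layer : N.IsInitialSegment l {v | N.layer v = l} :=
  ⟨fun _ hv => hv, fun _ _ _ hw _ => hw⟩

lemma IsInitialSegment.of_insert (h : N.IsInitialSegment l (insert a E))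
    (hmax : ∀ v ∈ E, v < a) : N.IsInitialSegment l E :=
  ⟨fun v hv => h.1 v (.inr hv), fun v hv w hw hwv =>
    (h.2 v (.inr hv) w hw hwv).resolve_left (hwv.trans_lt (hmax v hv)).ne⟩

lemma IsInitialSegment.subset_or_eq_insert (hE : N.IsInitialSegment l E)
    (hmax : ∀ v ∈ E, v < a) (hD : N.IsInitialSegment l D) (hDE : D ⊆ insert a E) :
    D ⊆ E ∨ D = insert a E := by
  by_cases ha : a ∈ D
  · exact .inr (hDE.antisymm (Set.insert_subset ha fun v hv =>
      hD.2 a ha v (hE.1 v hv) (hmax v hv).le))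
  · exact .inl fun v hv => (hDE hv).resolve_left (ne_of_mem_of_not_mem hv ha)

end InitialSegment

variable [Fintype V]

lemma Invariant.congr {Q Q' : Set (Port V n)} {x x' : InPort V n → Fin R → F}
    {y y' : OutPort V n → Fin R → F} (h : N.Invariant R Q x y) (hQ : Q' ⊆ Q)
    (heq : ∀ p ∈ Q', Sum.elim x y p = Sum.elim x' y' p) : N.Invariant R Q' x' y' :=
  fun W hW hreg => (linearIndepOn_congr fun p hp => heq p (hW p hp)).1
    (invariant_iff.1 h W (fun p hp => hQ (hW p hp)) hreg)

lemma received_congr {M : Type*} [AddCommGroup M] [Module F M] {k k' : OutPort V n → F}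
    {y y' : OutPort V n → M} {x : InPort V n}
    (h : ∀ p, N.link p x → k p = k' p ∧ y p = y' p) : N.received k y x = N.received k' y' x := by
  classical
  refine Finset.sum_congr rfl fun p hp => ?_
  obtain ⟨hk, hy⟩ := h p (Finset.mem_filter.1 hp).2
  rw [hk, hy]

lemma received_eq_zero {M : Type*} [AddCommGroup M] [Module F M] {x : InPort V n}
    (hx : N.layer x.1 = 1) (k : OutPort V n → F) (y : OutPort V n → M) :
    N.received k y x = 0 := by
  classical
  refine Finset.sum_eq_zero fun p hp => absurd (N.layer_pos p.1) ?_
  have hlink := N.layer_link p x (Finset.mem_filter.1 hp).2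
  lia

lemma IsRegular.node_eq_source {W : Finset (Port V n)} (hW : N.IsRegular F R W)
    (hl : ∀ p ∈ W, N.layer p.node = 1) : ∀ p ∈ W, p.node = N.source := by
  classical
  refine Finset.card_filter_eq_iff.1 (le_antisymm (Finset.card_filter_le _ _) ?_)
  exact hW.card_eq.trans_le (hW.le_capacity.trans (capacity_le_card_filter_source hl))

lemma invariant_source {x : InPort V n → Fin R → F} {y : OutPort V n → Fin R → F}
    (hx : ∀ i, x (N.source, i) = sourceInput n (fun r => Pi.single r (1 : F)) i) :
    N.Invariant R (N.frontier R 1 ∅) x y := by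
  intro W hW hreg
  have hport : ∀ p : {p // p ∈ W}, ∃ i : Fin n, p.1 = Sum.inl (N.source, i) ∧ (i : ℕ) < R := by
    rintro ⟨⟨v, i⟩ | ⟨v, j⟩, hp⟩
    · obtain rfl : v = N.source := hreg.node_eq_source (fun p hp => (hW p hp).1) _ hp
      exact ⟨i, rfl, (hW _ hp).2.2 rfl⟩
    · exact absurd (hW _ hp).2 (Set.notMem_empty _)
  choose i hi hiR using hport
  have hvector : (fun p : {p // p ∈ W} => Sum.elim x y p.1) =
      fun p => Pi.single (⟨i p, hiR p⟩ : Fin R) (1 : F) := by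
    funext p
    rw [hi p, Sum.elim_inl, hx, sourceInput, dif_pos (hiR p)]
  rw [hvector]
  exact (Pi.linearIndependent_single_one (Fin R) F).comp (fun p => ⟨i p, hiR p⟩) fun p p' h =>
    Subtype.ext (by rw [hi p, hi p', Fin.ext (Fin.mk.inj_iff.1 h)])

lemma span_range_input_eq_top {x : InPort V n → Fin R → F} {y : OutPort V n → Fin R → F} {v : V}
    (hv : v ≠ N.source) (hcut : (R : ℕ∞) ≤ N.toADT.mincut F N.source v)
    (hinv : N.Invariant R (N.frontier R (N.layer v) ∅) x y) :
    span F (Set.range fun i => x (v, i)) = ⊤ := by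
  obtain ⟨I, hI⟩ := exists_regular_inputs hv hcut
  have hports : ∀ p ∈ I.map (inputPort v), p ∈ N.frontier R (N.layer v) ∅ :=
    Finset.forall_mem_map.2 fun i _ =>
      ⟨rfl, (⟨Set.notMem_empty v, fun h => absurd h hv⟩ : v ∉ (∅ : Set V) ∧ _)⟩
  have hindep := invariant_iff.1 hinv _ hports hI
  rw [Finset.coe_map] at hindep
  have hx : LinearIndependent F fun i : I => x (v, i) :=
    hindep.comp_of_image (inputPort v).injective.injOn
  have hcard : I.card = R := (Finset.card_map _).symm.trans hI.card_eq
  rw [eq_top_iff, ← hx.span_eq_top_of_card_eq_finrank' (by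
    rw [Fintype.card_coe, hcard, finrank_fin_fun])]
  exact span_mono (Set.range_comp_subset_range _ fun i => x (v, i))

section LinearOrder

variable [LinearOrder V]

lemma exists_code_insert (hN : {v | N.layer v = l}.ncard ≤ Nlayer)
    (hF : ((n * Nlayer).choose R : ℕ∞) < ENat.card F) {E : Set V} {a : V}
    (hmax : ∀ v ∈ E, v < a) (hE : N.IsInitialSegment l (insert a E))
    {x : InPort V n → Fin R → F} {β : V → Fin n → Fin n → F}
    (hβ : ∀ D ⊆ E, N.IsInitialSegment l D → N.Invariant R (N.frontier R l D) x (encode β x)) :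
    ∃ β : V → Fin n → Fin n → F, ∀ D ⊆ insert a E, N.IsInitialSegment l D →
      N.Invariant R (N.frontier R l D) x (encode β x) := by
  have haE : a ∉ E := fun ha => (hmax a ha).false
  have hE' := hE.of_insert hmax
  obtain ⟨b, hb⟩ := exists_internal_coefficients hN hF (hE.1 a (.inl rfl)) haE
    (hβ E subset_rfl hE')
  refine ⟨Function.update β a b, fun D hDE hD => ?_⟩
  rw [encode_update]
  obtain hDE | rfl := hE'.subset_or_eq_insert hmax hD hDE
  · refine (hβ D hDE hD).congr subset_rfl ?_
    rintro (p | p) hp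
    · rfl
    · exact (if_neg (ne_of_mem_of_not_mem (hDE hp.2) haE)).symm
  · exact hb

theorem exists_layer_code (hN : {v | N.layer v = l}.ncard ≤ Nlayer)
    (hF : ((n * Nlayer).choose R : ℕ∞) < ENat.card F) {x : InPort V n → Fin R → F}
    {y : OutPort V n → Fin R → F} (hinv : N.Invariant R (N.frontier R l ∅) x y) :
    ∃ β : V → Fin n → Fin n → F, ∀ D, N.IsInitialSegment l D →
      N.Invariant R (N.frontier R l D) x (encode β x) := by
  suffices hfinite : ∀ E : Finset V, N.IsInitialSegment l E → ∃ β : V → Fin n → Fin n → F,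
      ∀ D ⊆ (E : Set V), N.IsInitialSegment l D →
        N.Invariant R (N.frontier R l D) x (encode β x) by
    obtain ⟨β, hβ⟩ := hfinite {v | N.layer v = l}
      (by simpa only [Finset.coe_filter_univ] using isInitialSegment_layer)
    exact ⟨β, fun D hD => hβ D (fun v hv => by simpa using hD.1 v hv) hD⟩
  intro E
  induction E using Finset.induction_on_max with
  | empty =>
    refine fun _ => ⟨0, fun D hD _ => ?_⟩
    obtain rfl : D = ∅ := by simpa using hD
    refine hinv.congr subset_rfl ?_
    rintro (p | p) hp
    · rfl
    · exact absurd hp.2 (Set.notMem_empty _)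
  | insert a E hmax ih =>
    intro hE
    rw [Finset.coe_insert] at hE ⊢
    obtain ⟨β, hβ⟩ := ih (hE.of_insert hmax)
    exact exists_code_insert hN hF hmax hE hβ

lemma exists_layer_step (hN : ∀ l, {v | N.layer v = l}.ncard ≤ Nlayer)
    (hF : ((n * Nlayer).choose R : ℕ∞) < ENat.card F) (hl : 1 ≤ l) {x : InPort V n → Fin R → F}
    (hinv : N.Invariant R (N.frontier R l ∅) x 0) :
    ∃ (β : V → Fin n → Fin n → F) (k : OutPort V n → F),
      (∀ D, N.IsInitialSegment l D → N.Invariant R (N.frontier R l D) x (encode β x)) ∧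
      N.Invariant R (N.frontier R (l + 1) ∅) (N.received k (encode β x)) 0 := by
  obtain ⟨β, hβ⟩ := exists_layer_code (hN l) hF hinv
  have hlinked : N.Invariant R (N.linkedOutputs l) x (encode β x) := by
    refine (hβ _ isInitialSegment_layer).congr ?_ fun _ _ => rfl
    rintro _ ⟨p, hp, -, rfl⟩
    exact ⟨hp, hp⟩
  obtain ⟨k, hk⟩ := exists_virtual_coefficients (hN (l + 1)) hF hl hlinked
  refine ⟨β, k, hβ, hk.congr ?_ ?_⟩ <;> rintro (p | p) hp
  · exact ⟨p, hp.1, rfl⟩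
  · exact absurd hp.2 (Set.notMem_empty _)
  · rfl
  · exact absurd hp.2 (Set.notMem_empty _)

theorem exists_layer_codes (hN : ∀ l, {v | N.layer v = l}.ncard ≤ Nlayer)
    (hF : ((n * Nlayer).choose R : ℕ∞) < ENat.card F) {x₁ : InPort V n → Fin R → F}
    (hx₁ : N.Invariant R (N.frontier R 1 ∅) x₁ 0) :
    ∃ (β : ℕ → V → Fin n → Fin n → F) (k : ℕ → OutPort V n → F) (x : ℕ → InPort V n → Fin R → F),
      x 0 = x₁ ∧ (∀ l, x (l + 1) = N.received (k l) (encode (β l) (x l))) ∧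
      ∀ l D, N.IsInitialSegment (l + 1) D →
        N.Invariant R (N.frontier R (l + 1) D) (x l) (encode (β l) (x l)) := by
  have hstep : ∀ l (x : InPort V n → Fin R → F), N.Invariant R (N.frontier R (l + 1) ∅) x 0 →
      ∃ (β : V → Fin n → Fin n → F) (k : OutPort V n → F),
        (∀ D, N.IsInitialSegment (l + 1) D →
          N.Invariant R (N.frontier R (l + 1) D) x (encode β x)) ∧
        N.Invariant R (N.frontier R (l + 2) ∅) (N.received k (encode β x)) 0 :=
    fun l x => exists_layer_step hN hF l.succ_pos
  choose! β k hβ hk using hstep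
  let x : ℕ → InPort V n → Fin R → F :=
    Nat.rec x₁ fun l x => N.received (k l x) (encode (β l x) x)
  have hx : ∀ l, N.Invariant R (N.frontier R (l + 1) ∅) (x l) 0 :=
    Nat.rec hx₁ fun l ih => hk l (x l) ih
  exact ⟨fun l => β l (x l), fun l => k l (x l), x, rfl, fun l => rfl, fun l => hβ l (x l) (hx l)⟩

theorem exists_code (hN : ∀ l, {v | N.layer v = l}.ncard ≤ Nlayer)
    (hF : ((n * Nlayer).choose R : ℕ∞) < ENat.card F) :
    ∃ (c : LinearCode V n F) (x : InPort V n → Fin R → F) (y : OutPort V n → Fin R → F),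
      c.Transmits N (sourceInput n fun r => Pi.single r (1 : F)) x y ∧
      ∀ l, 1 ≤ l → ∀ D, N.IsInitialSegment l D → N.Invariant R (N.frontier R l D) x y := by
  let x₁ : InPort V n → Fin R → F := fun p =>
    if p.1 = N.source then sourceInput n (fun r => Pi.single r (1 : F)) p.2 else 0
  have hsource : ∀ i, x₁ (N.source, i) = sourceInput n (fun r => Pi.single r (1 : F)) i :=
    fun i => if_pos rfl
  obtain ⟨β, k, x, hx₁, hx, hinv⟩ := exists_layer_codes hN hF (invariant_source hsource)
  let x' : InPort V n → Fin R → F := fun p => x (N.layer p.1 - 1) p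
  let y' : OutPort V n → Fin R → F := encode (fun v => β (N.layer v - 1) v) x'
  have hx' : ∀ l p, N.layer p.1 = l + 1 → x' p = x l p := fun l p hp => by
    simp only [x', hp, Nat.add_sub_cancel]
  have hy' : ∀ l p, N.layer p.1 = l + 1 → y' p = encode (β l) (x l) p := fun l p hp => by
    simp only [y', encode, x', hp, Nat.add_sub_cancel]
  refine ⟨⟨fun v => β (N.layer v - 1) v, fun p => k (N.layer p.1 - 1) p⟩, x', y',
    ⟨fun i => ?_, fun v hv i => ?_, fun v j => rfl⟩, fun l hl D hD => ?_⟩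
  · rw [hx' 0 _ N.layer_source, hx₁, hsource]
  · obtain ⟨l, hl⟩ := Nat.exists_eq_add_of_le' (N.layer_pos v)
    rw [hx' l _ hl]
    rcases l with _ | l
    · rw [hx₁, received_eq_zero hl]
      exact if_neg hv
    · rw [hx]
      refine received_congr fun p hp => ?_
      have hpl : N.layer p.1 = l + 1 := Nat.succ.inj ((N.layer_link p _ hp).symm.trans hl)
      exact ⟨by simp only [hpl, Nat.add_sub_cancel], (hy' l p hpl).symm⟩
  · obtain ⟨l, rfl⟩ := Nat.exists_eq_add_of_le' hl
    refine (hinv l D hD).congr subset_rfl ?_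
    rintro (p | p) hp
    · exact (hx' l p hp.1).symm
    · exact (hy' l p hp.1).symm

end LinearOrder

end Code

end LayeredNetwork

namespace LinearCode.Transmits

variable {V : Type*} [Fintype V] {n R : ℕ} {F M : Type*} [Field F] [AddCommGroup M] [Module F M]
  {c : LinearCode V n F} {N : LayeredNetwork V n}

lemma input_unique {s : Fin n → M} {x x' : InPort V n → M} {y y' : OutPort V n → M}
    (h : c.Transmits N s x y) (h' : c.Transmits N s x' y') (v : V) (i : Fin n) :
    x (v, i) = x' (v, i) := by
  induction hl : N.layer v using Nat.strong_induction_on generalizing v i with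
  | _ l ih =>
    by_cases hv : v = N.source
    · rw [hv, h.source_eq, h'.source_eq]
    · rw [h.input_eq v hv, h'.input_eq v hv]
      refine LayeredNetwork.received_congr fun p hp => ⟨rfl, ?_⟩
      have hlp : N.layer p.1 < l := hl ▸ N.layer_link p _ hp ▸ Nat.lt_succ_self _
      obtain ⟨w, j⟩ := p
      rw [h.output_eq, h'.output_eq]
      exact Finset.sum_congr rfl fun i _ => by rw [ih _ hlp w i rfl]

lemma map {M' : Type*} [AddCommGroup M'] [Module F M'] (f : M →ₗ[F] M') {s : Fin n → M}
    {x : InPort V n → M} {y : OutPort V n → M} (h : c.Transmits N s x y) :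
    c.Transmits N (fun i => f (s i)) (fun p => f (x p)) fun p => f (y p) where
  source_eq i := by rw [h.source_eq]
  input_eq v hv i := by simp only [h.input_eq v hv, LayeredNetwork.received, map_sum, map_smul]
  output_eq v j := by simp only [h.output_eq, map_sum, map_smul]

lemma exists_decoder {x : InPort V n → Fin R → F} {y : OutPort V n → Fin R → F}
    (h : c.Transmits N (sourceInput n fun r => Pi.single r (1 : F)) x y) {v : V}
    (hv : span F (Set.range fun i => x (v, i)) = ⊤) :
    ∃ ε : Fin R → Fin n → F, ∀ (u : Fin R → F) (sx : InPort V n → F) (sy : OutPort V n → F),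
      c.Transmits N (sourceInput n u) sx sy → ∀ r, ∑ i, ε r i * sx (v, i) = u r := by
  have hcombination : ∀ r : Fin R, ∃ ε : Fin n → F, ∑ i, ε i • x (v, i) = Pi.single r (1 : F) :=
    fun r => (mem_span_range_iff_exists_fun F).1 (hv ▸ mem_top)
  choose ε hε using hcombination
  refine ⟨ε, fun u sx sy hs r => ?_⟩
  let f : (Fin R → F) →ₗ[F] F := Fintype.linearCombination F u
  have hf : ∀ r, f (Pi.single r 1) = u r := fun r => by
    rw [Fintype.linearCombination_apply_single, one_smul]
  have hsource : (fun i => f (sourceInput n (fun r => Pi.single r (1 : F)) i)) =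
      sourceInput n u := by
    funext i
    simp only [sourceInput, apply_dite f, hf, map_zero]
  have hsx : ∀ i, sx (v, i) = f (x (v, i)) := hs.input_unique (hsource ▸ h.map f) v
  simp only [hsx, ← smul_eq_mul, ← map_smul, ← map_sum, hε, hf]

end LinearCode.Transmits

lemma choose_lt_card_of_mul_choose_lt_card {n m R : ℕ} {F : Type*} [Fintype F] [Nontrivial F]
    (h : n * (n * m).choose R < Fintype.card F) : (n * m).choose R < Fintype.card F := by
  rcases n.eq_zero_or_pos with rfl | hn
  · rcases R with _ | R <;> simp [Fintype.one_lt_card, Fintype.card_pos]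
  · exact (Nat.le_mul_of_pos_left _ hn).trans_lt h

open LayeredNetwork in
theorem mainTheorem4_general {V : Type*} [Fintype V] [LinearOrder V] {F : Type*} [Field F]
    (n R Nlayer : ℕ) (N : LayeredNetwork V n)
    (hN : ∀ l, {v | N.layer v = l}.ncard ≤ Nlayer) :
    (∀ l, 1 ≤ l → ∀ W' : Finset (InPort V n), (∀ x ∈ W', N.layer x.1 = l + 1) →
      N.IsRegular F R (W'.map Function.Embedding.inl) →
      ∃ W : Finset (OutPort V n), (∀ y ∈ W, N.layer y.1 = l) ∧
        N.IsRegular F R (W.map Function.Embedding.inr) ∧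
        ((N.toADT.incidence F).submatrix (fun y : {y // y ∈ W} => y.1)
          (fun x : {x // x ∈ W'} => x.1)).rank = R) ∧
    (((n * Nlayer).choose R : ℕ∞) < ENat.card F →
      (∀ l, 1 ≤ l → ∀ (x : InPort V n → Fin R → F) (y : OutPort V n → Fin R → F),
        N.Invariant R (N.linkedOutputs l) x y →
        ∃ k : OutPort V n → F, N.Invariant R (N.layerInputs (l + 1)) (N.received k y) y) ∧
      (∀ l (D : Set V) (v : V), N.layer v = l → v ∉ D →
        ∀ (x : InPort V n → Fin R → F) (y : OutPort V n → Fin R → F),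
        N.Invariant R (N.frontier R l D) x y →
        ∃ b : Fin n → Fin n → F,
          N.Invariant R (N.frontier R l (insert v D)) x (recode v b x y)) ∧
      ∃ (c : LinearCode V n F) (x : InPort V n → Fin R → F) (y : OutPort V n → Fin R → F),
        c.Transmits N (sourceInput n fun r => Pi.single r (1 : F)) x y ∧
        (∀ l, 1 ≤ l → ∀ D, N.IsInitialSegment l D → N.Invariant R (N.frontier R l D) x y) ∧
        ∀ v, v ≠ N.source → (R : ℕ∞) ≤ N.toADT.mincut F N.source v →
          ∃ ε : Fin R → Fin n → F, ∀ (u : Fin R → F) (sx : InPort V n → F) (sy : OutPort V n → F),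
            c.Transmits N (sourceInput n u) sx sy → ∀ r, ∑ i, ε r i * sx (v, i) = u r) := by
  refine ⟨fun l hl W' hW' hreg => exists_regular_outputs hl hW' hreg, fun hF =>
    ⟨fun l hl x y hinv => exists_virtual_coefficients (hN (l + 1)) hF hl hinv,
      fun l D v hv hvD x y hinv => exists_internal_coefficients (hN l) hF hv hvD hinv, ?_⟩⟩
  obtain ⟨c, x, y, htransmits, hinv⟩ := exists_code hN hF
  exact ⟨c, x, y, htransmits, hinv, fun v hv hcut => htransmits.exists_decoder
    (span_range_input_eq_top hv hcut (hinv _ (N.layer_pos v) ∅ isInitialSegment_empty))⟩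

theorem mainTheorem4 {V : Type*} [Fintype V] [LinearOrder V] {F : Type*} [Field F] [Fintype F]
    (n R Nlayer : ℕ) (N : LayeredNetwork V n)
    (hN : ∀ l, {v | N.layer v = l}.ncard ≤ Nlayer) :
    -- every regular set of input ports is fed with full rank by a regular set of output ports
    (∀ l, 1 ≤ l → l < N.depth → ∀ W' : Finset (InPort V n), (∀ x ∈ W', N.layer x.1 = l + 1) →
      N.IsRegular F R (W'.map Function.Embedding.inl) →
      ∃ W : Finset (OutPort V n), (∀ y ∈ W, N.layer y.1 = l) ∧
        N.IsRegular F R (W.map Function.Embedding.inr) ∧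
        ((N.toADT.incidence F).submatrix (fun y : {y // y ∈ W} => y.1)
          (fun x : {x // x ∈ W'} => x.1)).rank = R) ∧
    -- the step for the input ports of a layer
    (2 * (n * Nlayer).choose R < Fintype.card F →
      ∀ l, 1 ≤ l → l < N.depth →
      ∀ (x : InPort V n → Fin R → F) (y : OutPort V n → Fin R → F),
        N.Invariant R (N.linkedOutputs l) x y →
        ∃ k : OutPort V n → F, N.Invariant R (N.layerInputs (l + 1)) (N.received k y) y) ∧
    -- the step for the output ports of a supernode
    (n * (n * Nlayer).choose R < Fintype.card F →
      ∀ l, 1 ≤ l → l ≤ N.depth → ∀ (D : Set V) (v : V), N.layer v = l → v ∉ D →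
      ∀ (x : InPort V n → Fin R → F) (y : OutPort V n → Fin R → F),
        N.Invariant R (N.frontier R l D) x y →
        ∃ b : Fin n → Fin n → F,
          N.Invariant R (N.frontier R l (insert v D)) x (recode v b x y)) ∧
    -- the resulting multicast code
    (2 * (n * Nlayer).choose R < Fintype.card F → n * (n * Nlayer).choose R < Fintype.card F →
      ∃ (c : LinearCode V n F) (x : InPort V n → Fin R → F) (y : OutPort V n → Fin R → F),
        c.Transmits N (sourceInput n fun r => Pi.single r (1 : F)) x y ∧
        (∀ l, 1 ≤ l → l ≤ N.depth → ∀ D : Set V, (∀ v ∈ D, N.layer v = l) →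
          (∀ v ∈ D, ∀ w, N.layer w = l → w ≤ v → w ∈ D) →
          N.Invariant R (N.frontier R l D) x y) ∧
        ∀ v, v ≠ N.source → (R : ℕ∞) ≤ N.toADT.mincut F N.source v →
          ∃ ε : Fin R → Fin n → F, ∀ (u : Fin R → F) (sx : InPort V n → F) (sy : OutPort V n → F),
            c.Transmits N (sourceInput n u) sx sy →
            ∀ r, ∑ i, ε r i * sx (v, i) = u r) := by
  obtain ⟨houtputs, hcode⟩ := mainTheorem4_general (F := F) n R Nlayer N hN
  rw [ENat.card_eq_coe_fintype_card, Nat.cast_lt] at hcode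
  refine ⟨fun l hl _ => houtputs l hl, fun hq l hl _ => (hcode (by lia)).1 l hl,
    fun hq l _ _ => (hcode (choose_lt_card_of_mul_choose_lt_card hq)).2.1 l, fun hq _ => ?_⟩
  obtain ⟨c, x, y, htransmits, hinv, hdecode⟩ := (hcode (by lia)).2.2
  exact ⟨c, x, y, htransmits, fun l hl _ D hD hD' => hinv l hl D ⟨hD, hD'⟩, hdecode⟩
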